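/- Let $q$ be a prime power, $0<k<n$, and let $\mathcal C$ be an $[n,k]$ linear code over $\mathbb F_q$ with generator matrix $G$. A set $\mathcal I$ of $k$ coordinates is an information set if $G|_{\mathcal I}$ is invertible. Suppose that $\mathcal C$ is MDS-PIR capacity-achieving: for some positive integers $\kappa,\nu$ with $\kappa/\nu=k/n$ there is a binary $\nu\times n$ matrix, each column of which has Hamming weight $\kappa$, such that the support of each row contains an information set of $\mathcal C$. There are $f$ messages $W^{(1)},\dots,W^{(f)}$, matrices in $\mathbb F_q^{\beta\times k}$ whose $f\beta k$ entries are independent and uniform on $\mathbb F_q$; database $j\in\{1,\dots,n\}$ stores the $j$-th columns of $W^{(1)}G,\dots,W^{(f)}G$. Let $V\in\mathbb F_q^{\mu\times f}$ have rank $r\ge 1$, and let $X^{(v)}=\sum_{m}V_{v,m}W^{(m)}$, $1\le v\le\mu$, be the candidate linear functions, each of $L=\beta k$ symbols. To retrieve $X^{(v)}$ the user sends random queries $Q^{(v)}_1,\dots,Q^{(v)}_n$ (vectors over $\mathbb F_q$), jointly independent of the messages, and database $j$ replies with a vector $A^{(v)}_j$ of $d_j$ symbols of $\mathbb F_q$ that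 is a deterministic function of $Q^{(v)}_j$ and of its content. Such a scheme is a private linear computation (PLC) protocol if for every $v$ - (privacy) $I\bigl(v;\,Q^{(v)}_j,A^{(v)}_j,X^{(1)},\dots,X^{(\mu)}\bigr)=0$ for every single database $j$, where $v$ is drawn at random, with any law, independently of the messages; - (recovery) $H\bigl(X^{(v)}\mid A^{(v)}_1,\dots,A^{(v)}_n,Q^{(v)}_1,\dots,Q^{(v)}_n\bigr)=0$. Its rate is $L/D$, where the download cost $D$ is the number $\sum_j d_j$ of downloaded symbols or, alternatively, the downloaded information $\sum_j H(A^{(v)}_j)$ in $q$-ary units. The PLC capacity $C_{\mathrm{PLC}}$ is the maximum of the rates of all PLC protocols, over all $\beta\ge1$. Then, for either measure of the download cost, the maximum exists and $$C_{\mathrm{PLC}}=\Bigl(1-\frac kn\Bigr)\Bigl[1-\Bigl(\frac kn\Bigr)^r\Bigr]^{-1}.$$ -/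

import Mathlib

namespace PLC

/-! ### Shannon entropy of finitely valued random variables -/

/-- Entropy, in `b`-ary units, of the random variable `X` on the discrete probability space
`(Ω, p)`. -/
noncomputable def entropy (b : ℕ) {Ω α : Type*} [Fintype α] (p : PMF Ω) (X : Ω → α) : ℝ :=
  (∑ a, Real.negMulLog ((p.map X) a).toReal) / Real.log b

/-- Conditional entropy `H(X | Y) = H(X, Y) - H(Y)`. -/
noncomputable def condEntropy (b : ℕ) {Ω α γ : Type*} [Fintype α] [Fintype γ] (p : PMF Ω)
    (X : Ω → α) (Y : Ω → γ) : ℝ :=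
  entropy b p (fun ω => (X ω, Y ω)) - entropy b p Y

/-- Mutual information `I(X ; Y) = H(X) + H(Y) - H(X, Y)`. -/
noncomputable def mutualInfo (b : ℕ) {Ω α γ : Type*} [Fintype α] [Fintype γ] (p : PMF Ω)
    (X : Ω → α) (Y : Ω → γ) : ℝ :=
  entropy b p X + entropy b p Y - entropy b p (fun ω => (X ω, Y ω))

/-! ### Linear codes and PIR achievable rate matrices -/

/-- `G` is a generator matrix of an `[n,k]` code (its row space): its `k` rows are linearly
independent. -/
def IsGeneratorMatrix {F : Type*} [Field F] {k n : ℕ} (G : Matrix (Fin k) (Fin n) F) : Prop :=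
  LinearIndependent F G.row

/-- The coordinate set `I` is an information set: `|I| = k` and `G` restricted to the columns in
`I` is invertible. -/
def IsInformationSet {F : Type*} [Field F] {k n : ℕ} (G : Matrix (Fin k) (Fin n) F)
    (I : Finset (Fin n)) : Prop :=
  ∃ e : Fin k ≃ I, IsUnit (G.submatrix id (fun i => (e i : Fin n)))

/-- The binary `ν × n` matrix `Λ` is a PIR achievable rate matrix `Λ_{κ,ν}` for the code generated
by `G`: every column has Hamming weight `κ`, and the support of every row contains an information
set. -/
def IsPIRAchievableRateMatrix {F : Type*} [Field F] {k n : ℕ} (G : Matrix (Fin k) (Fin n) F)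
    (κ ν : ℕ) (Λ : Matrix (Fin ν) (Fin n) Bool) : Prop :=
  (∀ j, (Finset.univ.filter fun u => Λ u j = true).card = κ) ∧
    ∀ u, ∃ I : Finset (Fin n), IsInformationSet G I ∧ ∀ j ∈ I, Λ u j = true

/-- The code generated by `G` is MDS-PIR capacity-achieving: it has a PIR achievable rate matrix
with `κ / ν = k / n`. -/
def IsMDSPIRCapacityAchieving {F : Type*} [Field F] {k n : ℕ} (G : Matrix (Fin k) (Fin n) F) :
    Prop :=
  ∃ (κ ν : ℕ) (Λ : Matrix (Fin ν) (Fin n) Bool),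
    0 < ν ∧ IsPIRAchievableRateMatrix G κ ν Λ ∧ (κ : ℝ) / ν = (k : ℝ) / n

/-! ### The storage system -/

/-- The `f` messages, each a `β × k` matrix over `F`. -/
abbrev Messages (F : Type*) (f β k : ℕ) : Type _ := Fin f → Matrix (Fin β) (Fin k) F

/-- The content of database `j`: the `j`-th code symbols of all `β f` codewords, the rows of the
matrices `W⁽ᵐ⁾ G`. -/
def stored {F : Type*} [Field F] {n k f β : ℕ} (G : Matrix (Fin k) (Fin n) F)
    (w : Messages F f β k) (j : Fin n) : Fin f → Fin β → F :=
  fun m i => (w m * G) i j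

/-- The candidate linear functions `X⁽ᵛ⁾ = ∑ₘ V_{v,m} W⁽ᵐ⁾` (entrywise on the `β k` symbols). -/
def linFun {F : Type*} [Field F] {k f β μ : ℕ} (V : Matrix (Fin μ) (Fin f) F)
    (w : Messages F f β k) (v : Fin μ) : Matrix (Fin β) (Fin k) F :=
  ∑ m, V v m • w m

/-! ### Schemes and protocols -/

/-- A query-and-answer scheme, before any requirement on privacy or recovery. The query to database
`j` is a vector of `querySize j` symbols over `F`; the user draws all queries from a joint law that
depends on the requested index `v` only. Database `j` replies with `answerSize j` symbols, a
deterministic function of the query it receives and of its content. -/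
structure Scheme (F : Type*) (n f β μ : ℕ) where
  querySize : Fin n → ℕ
  answerSize : Fin n → ℕ
  queryLaw : Fin μ → PMF (∀ j, Fin (querySize j) → F)
  answer : ∀ j, (Fin (querySize j) → F) → (Fin f → Fin β → F) → (Fin (answerSize j) → F)

namespace Scheme

variable {F : Type*} {n f β μ : ℕ}

/-- The possible query tuples of a scheme. -/
abbrev Queries (P : Scheme F n f β μ) : Type _ := ∀ j, Fin (P.querySize j) → F

/-- The joint law of messages and queries when function `v` is requested: the message symbols are
independent and uniform on `F`, and the queries are independent of the messages. -/
noncomputable def law [Field F] [Fintype F] (k : ℕ) (P : Scheme F n f β μ) (v : Fin μ) :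
    PMF (Messages F f β k × P.Queries) :=
  (PMF.uniformOfFintype (Messages F f β k)).bind fun w =>
    (P.queryLaw v).map fun q => (w, q)

/-- The joint law of requested index, messages and queries when the index has law `θ`. -/
noncomputable def jointLaw [Field F] [Fintype F] (k : ℕ) (P : Scheme F n f β μ)
    (θ : PMF (Fin μ)) : PMF (Fin μ × Messages F f β k × P.Queries) :=
  θ.bind fun v => (P.law k v).map fun x => (v, x)

/-- The answer of database `j`, for given messages and queries. -/
def reply [Field F] {k : ℕ} (P : Scheme F n f β μ) (G : Matrix (Fin k) (Fin n) F)
    (x : Messages F f β k × P.Queries) (j : Fin n) : Fin (P.answerSize j) → F :=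
  P.answer j (x.2 j) (stored G x.1 j)

/-- Privacy: for each database `j`, `I(v ; Q_j, A_j, X⁽¹⁾, …, X⁽ᵘ⁾) = 0`, whatever the law of the
requested index `v`. -/
def IsPrivate [Field F] [Fintype F] {k : ℕ} (P : Scheme F n f β μ)
    (G : Matrix (Fin k) (Fin n) F) (V : Matrix (Fin μ) (Fin f) F) : Prop :=
  ∀ (θ : PMF (Fin μ)) (j : Fin n),
    mutualInfo (Fintype.card F) (P.jointLaw k θ) (fun x => x.1)
      (fun x => (x.2.2 j, P.reply G x.2 j, linFun V x.2.1)) = 0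

/-- Recovery: `H(X⁽ᵛ⁾ | A_1, …, A_n, Q_1, …, Q_n) = 0` for every requested index `v`. -/
def IsRecoverable [Field F] [Fintype F] {k : ℕ} (P : Scheme F n f β μ)
    (G : Matrix (Fin k) (Fin n) F) (V : Matrix (Fin μ) (Fin f) F) : Prop :=
  ∀ v : Fin μ,
    condEntropy (Fintype.card F) (P.law k v) (fun x => linFun V x.1 v)
      (fun x => (P.reply G x, x.2)) = 0

end Scheme

/-- A private linear computation protocol, with messages of `L = β k` symbols, for the storage code
generated by `G` and the coefficient matrix `V`. -/
structure Protocol {F : Type*} [Field F] [Fintype F] {n k f μ : ℕ}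
    (G : Matrix (Fin k) (Fin n) F) (V : Matrix (Fin μ) (Fin f) F) (β : ℕ)
    extends Scheme F n f β μ where
  isPrivate : toScheme.IsPrivate G V
  isRecoverable : toScheme.IsRecoverable G V

namespace Protocol

variable {F : Type*} [Field F] [Fintype F] {n k f μ β : ℕ}
  {G : Matrix (Fin k) (Fin n) F} {V : Matrix (Fin μ) (Fin f) F}

/-- The rate `L / D`, where `D` is the total number of downloaded symbols. -/
noncomputable def rate (P : Protocol G V β) : ℝ :=
  ((β * k : ℕ) : ℝ) / ∑ j, (P.answerSize j : ℝ)

/-- The rate `L / D`, where `D = ∑ⱼ H(Aⱼ⁽ᵛ⁾)` is the total amount of downloaded information, in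
`q`-ary units, when function `v` is requested (by privacy, the same for all `v`). -/
noncomputable def entropyRate (P : Protocol G V β) (v : Fin μ) : ℝ :=
  ((β * k : ℕ) : ℝ) /
    ∑ j, entropy (Fintype.card F) (P.law k v) (fun x => P.reply G x j)

end Protocol

/-- `C` is the private linear computation capacity for the storage code generated by `G` and the
coefficient matrix `V`: the maximum of the rates of all protocols, of any message length, where the
download cost may be measured by the number of downloaded symbols or by the entropy of the answers;
`C` is the maximum for either measure. -/
def IsCapacity {F : Type*} [Field F] [Fintype F] {n k f μ : ℕ}
    (G : Matrix (Fin k) (Fin n) F) (V : Matrix (Fin μ) (Fin f) F) (C : ℝ) : Prop :=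
  IsGreatest {R : ℝ | ∃ β : ℕ, 0 < β ∧ ∃ P : Protocol G V β, R = P.rate} C ∧
    IsGreatest {R : ℝ | ∃ β : ℕ, 0 < β ∧ ∃ P : Protocol G V β, ∃ v, R = P.entropyRate v} C

end PLC

/-! Put x = k/n = κ/ν and L = βk. Counting the ones of a rate matrix shows that each of its rows is
exactly an information set (`exists_informationSets`). So there are ν information sets covering
every database exactly κ times, and the proof uses nothing else about the code.

Converse. Take r independent candidates and condition on the first s of them. Under a request for
the next one, the answers reveal L fresh symbols (`le_cent_reply`); what they carry beyond that is
interference. Its size is controlled by two facts: the answers of an information set carry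
independent information (`sum_cent_reply_le`), and a single answer does not see the request.
Averaging over the ν information sets, a change of request costs only a factor x
(`mul_cent_reply_le`). Iteration gives D ≥ L(1 + x + … + x^(r-1)).

Achievability. Let E be the row space of V, of dimension r = d + 1. The messages define a linear map
on E whose value at row v is the candidate function v. Split E as F × B with (1, 0) going to the
requested row. A query is a linear map from the content space to families of alternating forms on E;
the database composes it with its content and returns the alternation, one degree higher. A form on
F × B amounts to its restriction to B together with its contraction by (1, 0). The shares of
database j restrict to blocks of the information sets containing j and contract to blocks, one
degree lower, of the others. The restricted answers form a codeword known on an information set,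
hence everywhere; this is exactly the interference in the contracted answers, and removing it leaves
the requested function (`eq_zero_of_share_answers`).

Privacy holds because the map from blocks to shares is onto for every request, and two surjections
onto the same space differ by an automorphism of the source, which a uniformly random isomorphism
absorbs (`alternatingScheme_isPrivate`). The binomial theorem gives β = ν^r and answers of κ(ν^r -
κ^r)/(ν - κ) symbols, which meets the converse with equality. -/

namespace PLC

/-! ### Shannon inequalities on a finite probability space -/

section Shannon

variable {Ω α γ δ : Type*}

/-- The probability of the event `X = a`. -/
noncomputable def prob (p : PMF Ω) (X : Ω → α) (a : α) : ℝ := ((p.map X) a).toReal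

theorem prob_nonneg (p : PMF Ω) (X : Ω → α) (a : α) : 0 ≤ prob p X a := ENNReal.toReal_nonneg

theorem toReal_pos {p : PMF Ω} {ω : Ω} (hω : p ω ≠ 0) : 0 < (p ω).toReal :=
  ENNReal.toReal_pos hω (p.apply_ne_top ω)

/-- `X` determines `Y` almost surely. -/
def Determines (p : PMF Ω) (X : Ω → α) (Y : Ω → γ) : Prop :=
  ∀ ω ω', p ω ≠ 0 → p ω' ≠ 0 → X ω = X ω' → Y ω = Y ω'

theorem Determines.of_comp {p : PMF Ω} {X : Ω → α} {Y : Ω → γ} (g : α → γ)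
    (h : ∀ ω, Y ω = g (X ω)) : Determines p X Y := fun ω ω' _ _ e => by rw [h, h, e]

variable [Fintype Ω]

/-- Entropy in natural units, as the expectation of the surprisal. -/
noncomputable def ent (p : PMF Ω) (X : Ω → α) : ℝ :=
  -∑ ω, (p ω).toReal * Real.log (prob p X (X ω))

open Classical in
theorem prob_eq_sum (p : PMF Ω) (X : Ω → α) (a : α) :
    prob p X a = ∑ ω, if X ω = a then (p ω).toReal else 0 := by
  unfold prob
  rw [PMF.map_apply, tsum_fintype, ENNReal.toReal_sum]
  · refine Finset.sum_congr rfl fun ω _ => ?_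
    by_cases h : X ω = a
    · simp [h]
    · simp [h, Ne.symm h]
  · intro ω _
    split_ifs
    · exact p.apply_ne_top ω
    · simp

theorem sum_toReal_apply (p : PMF Ω) : ∑ ω, (p ω).toReal = 1 := by
  rw [← ENNReal.toReal_sum fun ω _ => p.apply_ne_top ω, ← tsum_fintype (L := .unconditional Ω),
    p.tsum_coe, ENNReal.toReal_one]

theorem sum_prob [Fintype α] (p : PMF Ω) (X : Ω → α) : ∑ a, prob p X a = 1 := by
  classical
  simp_rw [prob_eq_sum]
  rw [Finset.sum_comm]
  simpa using sum_toReal_apply p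

theorem sum_mul_comp [Fintype α] (p : PMF Ω) (X : Ω → α) (g : α → ℝ) :
    ∑ ω, (p ω).toReal * g (X ω) = ∑ a, prob p X a * g a := by
  classical
  simp_rw [prob_eq_sum, Finset.sum_mul]
  rw [Finset.sum_comm]
  refine Finset.sum_congr rfl fun ω _ => ?_
  rw [Finset.sum_eq_single (X ω)] <;> simp +contextual [eq_comm]

theorem sum_prob_prodMk [Fintype α] (p : PMF Ω) (X : Ω → α) (Y : Ω → γ) (c : γ) :
    ∑ a, prob p (fun ω => (X ω, Y ω)) (a, c) = prob p Y c := by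
  classical
  simp_rw [prob_eq_sum]
  rw [Finset.sum_comm]
  refine Finset.sum_congr rfl fun ω _ => ?_
  by_cases h : Y ω = c <;> simp [h]

theorem sum_prob_prodMk' [Fintype γ] (p : PMF Ω) (X : Ω → α) (Y : Ω → γ) (a : α) :
    ∑ c, prob p (fun ω => (X ω, Y ω)) (a, c) = prob p X a := by
  classical
  simp_rw [prob_eq_sum]
  rw [Finset.sum_comm]
  refine Finset.sum_congr rfl fun ω _ => ?_
  by_cases h : X ω = a <;> simp [h]

theorem le_prob_self (p : PMF Ω) (X : Ω → α) (ω : Ω) : (p ω).toReal ≤ prob p X (X ω) := by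
  classical
  rw [prob_eq_sum]
  have := Finset.single_le_sum (f := fun ω' => if X ω' = X ω then (p ω').toReal else 0)
    (fun i _ => by positivity) (Finset.mem_univ ω)
  simpa using this

theorem entropy_eq_ent [Fintype α] (b : ℕ) (p : PMF Ω) (X : Ω → α) :
    entropy b p X = ent p X / Real.log b := by
  unfold entropy ent
  rw [sum_mul_comp p X fun a => Real.log (prob p X a), ← Finset.sum_neg_distrib]
  simp [Real.negMulLog, prob]

theorem Determines.prob_le {p : PMF Ω} {X : Ω → α} {Y : Ω → γ} (h : Determines p X Y) {ω : Ω}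
    (hω : p ω ≠ 0) : prob p X (X ω) ≤ prob p Y (Y ω) := by
  classical
  simp_rw [prob_eq_sum]
  refine Finset.sum_le_sum fun ω' _ => ?_
  by_cases h0 : p ω' = 0
  · simp [h0]
  by_cases hX : X ω' = X ω
  · simp [hX, h ω' ω h0 hω hX]
  · simp only [hX, if_false]
    positivity

theorem prob_self_pos {p : PMF Ω} (X : Ω → α) {ω : Ω} (hω : p ω ≠ 0) : 0 < prob p X (X ω) :=
  (toReal_pos hω).trans_le (le_prob_self p X ω)

theorem Determines.ent_le {p : PMF Ω} {X : Ω → α} {Y : Ω → γ} (h : Determines p X Y) :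
    ent p Y ≤ ent p X := by
  refine neg_le_neg (Finset.sum_le_sum fun ω _ => ?_)
  by_cases h0 : p ω = 0
  · simp [h0]
  · exact mul_le_mul_of_nonneg_left (Real.log_le_log (prob_self_pos X h0) (h.prob_le h0))
      ENNReal.toReal_nonneg

theorem Determines.ent_eq {p : PMF Ω} {X : Ω → α} {Y : Ω → γ} (h : Determines p X Y)
    (h' : Determines p Y X) : ent p X = ent p Y :=
  le_antisymm h'.ent_le h.ent_le

theorem ent_nonneg [Fintype α] (p : PMF Ω) (X : Ω → α) : 0 ≤ ent p X := by
  unfold ent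
  rw [sum_mul_comp p X fun a => Real.log (prob p X a), ← Finset.sum_neg_distrib]
  refine Finset.sum_nonneg fun a _ => ?_
  have h1 : prob p X a ≤ 1 := by
    rw [← sum_prob p X]
    exact Finset.single_le_sum (fun a _ => prob_nonneg p X a) (Finset.mem_univ a)
  have := Real.negMulLog_nonneg (prob_nonneg p X a) h1
  simpa [Real.negMulLog] using this

/-- In place of Jensen's inequality, log t ≤ t - 1 is applied pointwise on the support, with t the
ratio of the uniform to the actual probability; the mean of t is at most 1. -/
theorem ent_le_log_card [Fintype α] (p : PMF Ω) (X : Ω → α) :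
    ent p X ≤ Real.log (Fintype.card α) := by
  obtain ⟨ω₀, -⟩ := p.support_nonempty
  have hc : (0 : ℝ) < Fintype.card α := by
    have : Nonempty α := ⟨X ω₀⟩
    exact_mod_cast Fintype.card_pos
  have key : ∀ ω, (p ω).toReal * (-Real.log (prob p X (X ω)) - Real.log (Fintype.card α)) ≤
      (p ω).toReal * ((Fintype.card α : ℝ)⁻¹ * (prob p X (X ω))⁻¹ - 1) := by
    intro ω
    by_cases h0 : p ω = 0
    · simp [h0]
    refine mul_le_mul_of_nonneg_left ?_ ENNReal.toReal_nonneg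
    have hp := prob_self_pos X h0
    have := Real.log_le_sub_one_of_pos (x := (Fintype.card α : ℝ)⁻¹ * (prob p X (X ω))⁻¹)
      (by positivity)
    rw [Real.log_mul (by positivity) (by positivity), Real.log_inv, Real.log_inv] at this
    linarith
  have hs := Finset.sum_le_sum fun ω (_ : ω ∈ Finset.univ) => key ω
  rw [sum_mul_comp p X fun a => (Fintype.card α : ℝ)⁻¹ * (prob p X a)⁻¹ - 1] at hs
  have h1 : ∑ a, prob p X a * ((Fintype.card α : ℝ)⁻¹ * (prob p X a)⁻¹ - 1) ≤ 0 := by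
    simp_rw [mul_sub, mul_one]
    rw [Finset.sum_sub_distrib, sum_prob, sub_nonpos]
    calc _ ≤ ∑ _a : α, (Fintype.card α : ℝ)⁻¹ := by
          refine Finset.sum_le_sum fun a _ => ?_
          rcases (prob_nonneg p X a).eq_or_lt with h | h
          · rw [← h]; simp
          · rw [mul_left_comm, mul_inv_cancel₀ h.ne', mul_one]
      _ = 1 := by simp [hc.ne']
  simp_rw [mul_sub] at hs
  rw [Finset.sum_sub_distrib, ← Finset.sum_mul, sum_toReal_apply] at hs
  unfold ent
  simp_rw [mul_neg, Finset.sum_neg_distrib] at hs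
  simp_rw [mul_sub] at h1
  linarith

/-- Submodularity of entropy. -/
theorem ent_submodular [Fintype α] [Fintype γ] [Fintype δ] (p : PMF Ω) (X : Ω → α) (Y : Ω → γ)
    (Z : Ω → δ) :
    ent p (fun ω => (X ω, Y ω, Z ω)) + ent p Z ≤
      ent p (fun ω => (X ω, Z ω)) + ent p (fun ω => (Y ω, Z ω)) := by
  set T : Ω → α × γ × δ := fun ω => (X ω, Y ω, Z ω) with hT
  set XZ : Ω → α × δ := fun ω => (X ω, Z ω) with hXZ
  set YZ : Ω → γ × δ := fun ω => (Y ω, Z ω) with hYZ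
  -- The ratio of the law making X and Y conditionally independent given Z to the true joint law.
  -- Its mean is at most 1, so log t ≤ t - 1 gives the inequality.
  set g : α × γ × δ → ℝ := fun t =>
    prob p XZ (t.1, t.2.2) * prob p YZ t.2 * (prob p Z t.2.2)⁻¹ * (prob p T t)⁻¹ with hg
  have key : ∀ ω, (p ω).toReal * (Real.log (prob p XZ (XZ ω)) + Real.log (prob p YZ (YZ ω)) -
      Real.log (prob p Z (Z ω)) - Real.log (prob p T (T ω))) ≤ (p ω).toReal * (g (T ω) - 1) := by
    intro ω
    by_cases h0 : p ω = 0
    · simp [h0]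
    refine mul_le_mul_of_nonneg_left ?_ ENNReal.toReal_nonneg
    have h1 := prob_self_pos XZ h0
    have h2 := prob_self_pos YZ h0
    have h3 := prob_self_pos Z h0
    have h4 := prob_self_pos T h0
    have := Real.log_le_sub_one_of_pos (x := prob p XZ (XZ ω) * prob p YZ (YZ ω) *
      (prob p Z (Z ω))⁻¹ * (prob p T (T ω))⁻¹) (by positivity)
    rw [Real.log_mul (by positivity) (by positivity), Real.log_mul (by positivity) (by positivity),
      Real.log_mul (by positivity) (by positivity), Real.log_inv, Real.log_inv] at this
    simp only [hg]
    linarith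
  have hs := Finset.sum_le_sum fun ω (_ : ω ∈ Finset.univ) => key ω
  rw [sum_mul_comp p T fun t => g t - 1] at hs
  have h1 : ∑ t, prob p T t * (g t - 1) ≤ 0 := by
    simp_rw [mul_sub, mul_one]
    rw [Finset.sum_sub_distrib, sum_prob, sub_nonpos]
    calc ∑ t, prob p T t * g t
        ≤ ∑ t : α × γ × δ, prob p XZ (t.1, t.2.2) * prob p YZ t.2 * (prob p Z t.2.2)⁻¹ := by
          refine Finset.sum_le_sum fun t _ => ?_
          have h1 := prob_nonneg p XZ (t.1, t.2.2)
          have h2 := prob_nonneg p YZ t.2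
          have h3 := prob_nonneg p Z t.2.2
          rcases (prob_nonneg p T t).eq_or_lt with h | h
          · rw [← h, zero_mul]; positivity
          · simp only [hg]
            rw [mul_left_comm, mul_inv_cancel₀ h.ne', mul_one]
      _ = ∑ c, prob p Z c * (prob p Z c * (prob p Z c)⁻¹) := by
          rw [Fintype.sum_prod_type, Finset.sum_comm, Fintype.sum_prod_type, Finset.sum_comm]
          refine Finset.sum_congr rfl fun c _ => ?_
          rw [← sum_prob_prodMk p X Z c]
          simp_rw [← Finset.sum_mul]
          rw [sum_prob_prodMk p X Z c, ← Finset.mul_sum, sum_prob_prodMk p Y Z c, mul_assoc]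
      _ ≤ ∑ c, prob p Z c := by
          refine Finset.sum_le_sum fun c _ => ?_
          rcases (prob_nonneg p Z c).eq_or_lt with h | h
          · rw [← h]; simp
          · rw [mul_inv_cancel₀ h.ne', mul_one]
      _ = 1 := sum_prob p Z
  simp_rw [mul_sub, mul_add] at hs
  simp_rw [mul_sub] at h1
  rw [Finset.sum_sub_distrib, Finset.sum_sub_distrib, Finset.sum_add_distrib] at hs
  unfold ent
  linarith

/-- Additivity of entropy for independent random variables. -/
theorem ent_prodMk_of_indep {p : PMF Ω} {X : Ω → α} {Y : Ω → γ}
    (h : ∀ a c, prob p (fun ω => (X ω, Y ω)) (a, c) = prob p X a * prob p Y c) :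
    ent p (fun ω => (X ω, Y ω)) = ent p X + ent p Y := by
  unfold ent
  rw [← neg_add, ← Finset.sum_add_distrib]
  congr 1
  refine Finset.sum_congr rfl fun ω _ => ?_
  by_cases h0 : p ω = 0
  · simp [h0]
  rw [h, Real.log_mul (prob_self_pos X h0).ne' (prob_self_pos Y h0).ne', mul_add]

/-- Random variables without mutual information are independent. -/
theorem indep_of_ent_prodMk [Fintype α] [Fintype γ] {p : PMF Ω} {X : Ω → α} {Y : Ω → γ}
    (h : ent p (fun ω => (X ω, Y ω)) = ent p X + ent p Y) (a : α) (c : γ) :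
    prob p (fun ω => (X ω, Y ω)) (a, c) = prob p X a * prob p Y c := by
  set T : Ω → α × γ := fun ω => (X ω, Y ω) with hT
  -- The summands of the relative entropy of the joint law to the product law, in the nonnegative
  -- form with `klFun`. Their sum is zero by hypothesis, so each vanishes.
  set k : α × γ → ℝ := fun t =>
    prob p X t.1 * prob p Y t.2 * InformationTheory.klFun (prob p T t /
      (prob p X t.1 * prob p Y t.2)) with hk
  have hX : ∀ t : α × γ, prob p T t ≤ prob p X t.1 := fun t => by
    rw [← sum_prob_prodMk' p X Y]
    exact Finset.single_le_sum (f := fun c => prob p T (t.1, c)) (fun c _ => prob_nonneg p T _)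
      (Finset.mem_univ t.2)
  have hY : ∀ t : α × γ, prob p T t ≤ prob p Y t.2 := fun t => by
    rw [← sum_prob_prodMk p X Y]
    exact Finset.single_le_sum (f := fun a => prob p T (a, t.2)) (fun c _ => prob_nonneg p T _)
      (Finset.mem_univ t.1)
  have hk0 : ∀ t, 0 ≤ k t := fun t => mul_nonneg
    (mul_nonneg (prob_nonneg p X _) (prob_nonneg p Y _))
    (InformationTheory.klFun_nonneg (div_nonneg (prob_nonneg p T t)
      (mul_nonneg (prob_nonneg p X _) (prob_nonneg p Y _))))
  have hkt : ∀ t, k t = prob p T t * (Real.log (prob p T t) - Real.log (prob p X t.1) -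
      Real.log (prob p Y t.2)) + prob p X t.1 * prob p Y t.2 - prob p T t := by
    intro t
    simp only [hk]
    rcases (prob_nonneg p X t.1).eq_or_lt with h1 | h1
    · have : prob p T t = 0 := le_antisymm (h1 ▸ hX t) (prob_nonneg p T t)
      rw [this, ← h1]; simp
    rcases (prob_nonneg p Y t.2).eq_or_lt with h2 | h2
    · have : prob p T t = 0 := le_antisymm (h2 ▸ hY t) (prob_nonneg p T t)
      rw [this, ← h2]; simp
    rcases (prob_nonneg p T t).eq_or_lt with h3 | h3
    · rw [← h3]; simp [InformationTheory.klFun]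
    rw [InformationTheory.klFun, Real.log_div h3.ne' (by positivity), Real.log_mul h1.ne' h2.ne']
    field_simp
    ring
  have hsum : ∑ t, k t = 0 := by
    simp_rw [hkt]
    rw [Finset.sum_sub_distrib, Finset.sum_add_distrib, sum_prob, Fintype.sum_prod_type
      (f := fun t : α × γ => prob p X t.1 * prob p Y t.2)]
    simp_rw [← Finset.mul_sum]
    rw [sum_prob]
    simp_rw [mul_one]
    rw [sum_prob, ← sum_mul_comp p T fun t => (Real.log (prob p T t) - Real.log (prob p X t.1) -
      Real.log (prob p Y t.2))]
    simp_rw [mul_sub]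
    rw [Finset.sum_sub_distrib, Finset.sum_sub_distrib]
    unfold ent at h
    simp only [hT] at h ⊢
    linarith
  have h0 : k (a, c) = 0 :=
    (Finset.sum_eq_zero_iff_of_nonneg fun t _ => hk0 t).1 hsum (a, c) (Finset.mem_univ _)
  rcases mul_eq_zero.1 h0 with h1 | h1
  · rw [h1]
    rcases mul_eq_zero.1 h1 with h2 | h2
    · exact le_antisymm (h2 ▸ hX (a, c)) (prob_nonneg p T _)
    · exact le_antisymm (h2 ▸ hY (a, c)) (prob_nonneg p T _)
  · rw [InformationTheory.klFun_eq_zero_iff (div_nonneg (prob_nonneg p T _)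
      (mul_nonneg (prob_nonneg p X _) (prob_nonneg p Y _)))] at h1
    exact eq_of_div_eq_one h1

/-- A random variable of zero conditional entropy is determined by the condition. -/
theorem determines_of_ent_prodMk {p : PMF Ω} {X : Ω → α} {Y : Ω → γ}
    (h : ent p (fun ω => (X ω, Y ω)) = ent p Y) : Determines p Y X := by
  classical
  have hd : Determines p (fun ω => (X ω, Y ω)) Y := fun _ _ _ _ h => (Prod.ext_iff.1 h).2
  set T : Ω → α × γ := fun ω => (X ω, Y ω) with hT
  have hnn : ∀ ω, 0 ≤ (p ω).toReal * (Real.log (prob p Y (Y ω)) - Real.log (prob p T (T ω))) := by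
    intro ω
    by_cases h0 : p ω = 0
    · simp [h0]
    exact mul_nonneg ENNReal.toReal_nonneg
      (sub_nonneg.2 (Real.log_le_log (prob_self_pos T h0) (hd.prob_le h0)))
  have hs : ∑ ω, (p ω).toReal * (Real.log (prob p Y (Y ω)) - Real.log (prob p T (T ω))) = 0 := by
    simp_rw [mul_sub]
    rw [Finset.sum_sub_distrib]
    unfold ent at h
    linarith
  intro ω ω' hω hω' hY
  have h0 := (Finset.sum_eq_zero_iff_of_nonneg fun ω _ => hnn ω).1 hs ω (Finset.mem_univ ω)
  have h1 : prob p Y (Y ω) = prob p T (T ω) := by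
    rcases mul_eq_zero.1 h0 with h | h
    · exact absurd h (toReal_pos hω).ne'
    · exact Real.log_injOn_pos (prob_self_pos Y hω) (prob_self_pos T hω) (sub_eq_zero.1 h)
  by_contra hX
  rw [prob_eq_sum, prob_eq_sum] at h1
  -- The point ω' has positive mass in the event for Y but lies outside the event for the pair, so
  -- the two probabilities would differ.
  refine absurd h1 (ne_of_gt (Finset.sum_lt_sum (fun i _ => ?_) ⟨ω', Finset.mem_univ _, ?_⟩))
  · by_cases hi : T i = T ω
    · have : Y i = Y ω := (Prod.ext_iff.1 hi).2
      simp [hi, this]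
    · simp only [hi, if_false]
      positivity
  · have : ¬T ω' = T ω := fun e => hX (Prod.ext_iff.1 e).1.symm
    simp [this, hY, toReal_pos hω']

/-- Entropy depends on the law only. -/
theorem ent_eq_of_map_eq {Ω' : Type*} [Fintype Ω'] [Fintype α] {p : PMF Ω} {p' : PMF Ω'}
    {X : Ω → α} {X' : Ω' → α} (h : p.map X = p'.map X') : ent p X = ent p' X' := by
  unfold ent
  rw [sum_mul_comp p X fun a => Real.log (prob p X a),
    sum_mul_comp p' X' fun a => Real.log (prob p' X' a)]
  simp only [prob, h]

/-! ### Conditional entropy -/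

/-- Conditional entropy in natural units. -/
noncomputable def cent (p : PMF Ω) (X : Ω → α) (Y : Ω → γ) : ℝ :=
  ent p (fun ω => (X ω, Y ω)) - ent p Y

theorem cent_nonneg (p : PMF Ω) (X : Ω → α) (Y : Ω → γ) : 0 ≤ cent p X Y := by
  have h : Determines p (fun ω => (X ω, Y ω)) Y := .of_comp Prod.snd fun _ => rfl
  exact sub_nonneg.2 h.ent_le

/-- Conditioning on more reduces entropy. -/
theorem cent_le_cent {p : PMF Ω} [Fintype α] [Fintype γ] [Fintype δ] {X : Ω → α} {Y : Ω → γ}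
    {Z : Ω → δ} (h : Determines p Z Y) : cent p X Z ≤ cent p X Y := by
  have h1 := ent_submodular p X Z Y
  have h2 : ent p (fun ω => (X ω, Z ω)) ≤ ent p (fun ω => (X ω, Z ω, Y ω)) :=
    Determines.ent_le (.of_comp (fun t => (t.1, t.2.1)) fun _ => rfl)
  have h3 : ent p (fun ω => (Z ω, Y ω)) ≤ ent p Z :=
    Determines.ent_le fun ω ω' h0 h0' e => Prod.ext e (h ω ω' h0 h0' e)
  unfold cent
  linarith

theorem cent_le_ent [Fintype α] [Fintype γ] (p : PMF Ω) (X : Ω → α) (Y : Ω → γ) :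
    cent p X Y ≤ ent p X := by
  have h1 := ent_submodular p X Y fun _ => ()
  have h2 : ent p (fun ω => (X ω, Y ω)) ≤ ent p (fun ω => (X ω, Y ω, ())) :=
    Determines.ent_le (.of_comp (fun t => (t.1, t.2.1)) fun _ => rfl)
  have h3 : ent p (fun ω => (X ω, ())) ≤ ent p X :=
    Determines.ent_le (.of_comp (fun t => (t, ())) fun _ => rfl)
  have h4 : ent p (fun ω => (Y ω, ())) ≤ ent p Y :=
    Determines.ent_le (.of_comp (fun t => (t, ())) fun _ => rfl)
  have := ent_nonneg p fun _ => ()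
  unfold cent
  linarith

theorem ent_prodMk_le [Fintype α] [Fintype γ] (p : PMF Ω) (X : Ω → α) (Y : Ω → γ) :
    ent p (fun ω => (X ω, Y ω)) ≤ ent p X + ent p Y := by
  have := cent_le_ent p X Y
  unfold cent at this
  linarith

/-- Conditional subadditivity for a finite family. -/
theorem cent_restrict_le {ι : Type*} {κ : ι → Type*} [∀ i, Fintype (κ i)] [Fintype δ] (p : PMF Ω)
    (Y : ∀ i, Ω → κ i) (Z : Ω → δ) (s : Finset ι) :
    cent p (fun ω (i : s) => Y i ω) Z ≤ ∑ i ∈ s, cent p (Y i) Z := by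
  classical
  induction s using Finset.induction_on with
  | empty =>
    have : ent p (fun ω => ((fun i : (∅ : Finset ι) => Y i ω), Z ω)) ≤ ent p Z :=
      Determines.ent_le fun ω ω' _ _ e =>
        Prod.ext (funext fun i => absurd i.2 (Finset.notMem_empty _)) e
    simpa [cent] using this
  | insert a s ha ih =>
    rw [Finset.sum_insert ha]
    have h1 := ent_submodular p (Y a) (fun ω (i : s) => Y i ω) Z
    have h2 : ent p (fun ω => ((fun i : (insert a s : Finset ι) => Y i ω), Z ω)) ≤
        ent p (fun ω => (Y a ω, (fun i : s => Y i ω), Z ω)) := by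
      refine Determines.ent_le fun ω ω' _ _ e => ?_
      simp only [Prod.mk.injEq] at e ⊢
      refine ⟨funext fun i => ?_, e.2.2⟩
      rcases Finset.mem_insert.1 i.2 with h | h
      · obtain ⟨i, hi⟩ := i
        obtain rfl : i = a := h
        exact e.1
      · exact congrFun e.2.1 ⟨i, h⟩
    unfold cent at ih ⊢
    linarith

theorem cent_congr {α' γ' : Type*} {p : PMF Ω} {X : Ω → α} {Y : Ω → γ} {X' : Ω → α'} {Y' : Ω → γ'}
    (h1 : Determines p (fun ω => (X ω, Y ω)) fun ω => (X' ω, Y' ω))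
    (h2 : Determines p (fun ω => (X' ω, Y' ω)) fun ω => (X ω, Y ω))
    (h3 : Determines p Y Y') (h4 : Determines p Y' Y) : cent p X Y = cent p X' Y' := by
  unfold cent
  rw [h1.ent_eq h2, h3.ent_eq h4]

end Shannon

/-! ### Joint laws built from a mixing law and a kernel -/

section Laws

variable {ι α γ : Type*}

theorem bind_map_prodMk_apply (θ : PMF ι) (K : ι → PMF α) (i : ι) (a : α) :
    (θ.bind fun i => (K i).map fun a => (i, a)) (i, a) = θ i * K i a := by
  classical
  rw [PMF.bind_apply, tsum_eq_single i]
  · rw [PMF.map_apply, tsum_eq_single a]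
    · simp
    · intro b hb
      simp [hb.symm]
  · intro i' hi'
    rw [PMF.map_apply]
    simp [hi'.symm]

/-- The kernel R is constant, so θ and R are the two marginals and the joint mass is their product.
-/
theorem indep_of_bind_map {Ω : Type*} [Fintype Ω] {p : PMF Ω} {X : Ω → ι} {Y : Ω → α} {θ : PMF ι}
    {R : PMF α}
    (h : p.map (fun ω => (X ω, Y ω)) = θ.bind fun i => R.map fun a => (i, a)) (i : ι) (a : α) :
    prob p (fun ω => (X ω, Y ω)) (i, a) = prob p X i * prob p Y a := by
  have hX : p.map X = θ := by
    have := congrArg (PMF.map Prod.fst) h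
    rw [PMF.map_comp, PMF.map_bind] at this
    simp_rw [PMF.map_comp] at this
    have e : ∀ i : ι, R.map (Prod.fst ∘ fun a : α => (i, a)) = PMF.pure i := fun i =>
      PMF.map_const R i
    simp_rw [e] at this
    rw [PMF.bind_pure] at this
    exact this
  have hY : p.map Y = R := by
    have := congrArg (PMF.map Prod.snd) h
    rw [PMF.map_comp, PMF.map_bind] at this
    simp_rw [PMF.map_comp] at this
    have e : ∀ i : ι, R.map (Prod.snd ∘ fun a : α => (i, a)) = R := fun i => PMF.map_id R
    simp_rw [e] at this
    rw [PMF.bind_const] at this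
    exact this
  unfold prob
  rw [h, hX, hY, bind_map_prodMk_apply, ENNReal.toReal_mul]

end Laws

theorem log_card_pi (d : ℕ) {F N : Type*} [Fintype F] [Fintype N] {e : ℕ}
    (hN : Fintype.card N = Fintype.card F ^ e) :
    Real.log (Fintype.card (Fin d → N)) = (d * e : ℕ) * Real.log (Fintype.card F) := by
  rw [Fintype.card_fun, Fintype.card_fin, hN, ← pow_mul, mul_comm e d]
  push_cast
  rw [Real.log_pow]
  push_cast
  rfl

theorem card_matrix_eq {F : Type*} [Fintype F] {β k : ℕ} :
    Fintype.card (Matrix (Fin β) (Fin k) F) = Fintype.card F ^ (β * k) := by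
  rw [show Fintype.card (Matrix (Fin β) (Fin k) F) =
    Fintype.card (Fin β → Fin k → F) from Fintype.card_congr Matrix.of.symm]
  rw [Fintype.card_fun, Fintype.card_fun, Fintype.card_fin, Fintype.card_fin, ← pow_mul, mul_comm]

/-! ### What privacy and recovery mean for the laws -/

namespace Scheme

variable {F : Type*} [Field F] [Fintype F] {n f β μ k : ℕ}

theorem law_apply (P : Scheme F n f β μ) (v : Fin μ) (x : Messages F f β k × P.Queries) :
    P.law k v x = (Fintype.card (Messages F f β k) : ENNReal)⁻¹ * P.queryLaw v x.2 := by
  rw [law, bind_map_prodMk_apply, PMF.uniformOfFintype_apply]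

theorem ent_law (P : Scheme F n f β μ) (v : Fin μ) :
    ent (P.law k v) (fun x => (x.1, x.2)) =
      (f * (β * k) : ℕ) * Real.log (Fintype.card F) + ent (P.law k v) fun x => x.2 := by
  have h : ∀ w q, prob (P.law k v) (fun x => (x.1, x.2)) (w, q) =
      prob (P.law k v) (fun x => x.1) w * prob (P.law k v) (fun x => x.2) q :=
    indep_of_bind_map (PMF.map_id _)
  rw [ent_prodMk_of_indep h]
  congr 1
  have h1 : (P.law k v).map (fun x => x.1) = PMF.uniformOfFintype (Messages F f β k) := by
    rw [law, PMF.map_bind]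
    simp_rw [PMF.map_comp]
    have e : ∀ w : Messages F f β k, (P.queryLaw v).map
        ((fun x : Messages F f β k × P.Queries => x.1) ∘ fun q => (w, q)) = PMF.pure w :=
      fun w => PMF.map_const _ w
    simp_rw [e]
    exact PMF.bind_pure _
  unfold ent
  simp_rw [prob, h1, PMF.uniformOfFintype_apply]
  rw [← Finset.sum_mul, sum_toReal_apply]
  have hc : Fintype.card (Messages F f β k) = Fintype.card F ^ (f * (β * k)) := by
    rw [Fintype.card_fun, Fintype.card_fin]
    rw [card_matrix_eq, ← pow_mul, mul_comm]
  rw [hc]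
  simp

/-- Privacy means that the query, the answer and the candidate functions have a joint law which
does not depend on the requested index. -/
theorem IsPrivate.map_law_eq {P : Scheme F n f β μ} {G : Matrix (Fin k) (Fin n) F}
    {V : Matrix (Fin μ) (Fin f) F} (h : P.IsPrivate G V) (j : Fin n) (v v' : Fin μ) :
    (P.law k v).map (fun x => (x.2 j, P.reply G x j, linFun V x.1)) =
      (P.law k v').map (fun x => (x.2 j, P.reply G x j, linFun V x.1)) := by
  have : Nonempty (Fin μ) := ⟨v⟩
  set Y : Messages F f β k × P.Queries → _ := fun x => (x.2 j, P.reply G x j, linFun V x.1) with hY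
  -- A request law charging every index lets its mass be cancelled from the product formula.
  set θ := PMF.uniformOfFintype (Fin μ) with hθ
  have h0 := h θ j
  unfold mutualInfo at h0
  simp_rw [entropy_eq_ent] at h0
  have hlog : Real.log (Fintype.card F) ≠ 0 :=
    (Real.log_pos (by exact_mod_cast Fintype.one_lt_card)).ne'
  have h1 := indep_of_ent_prodMk (p := P.jointLaw k θ) (X := fun x => x.1) (Y := fun x => Y x.2)
    (by simp only [hY]; field_simp at h0; linarith)
  have hmap : (P.jointLaw k θ).map (fun x => (x.1, Y x.2)) =
      θ.bind fun v => ((P.law k v).map Y).map fun y => (v, y) := by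
    rw [jointLaw, PMF.map_bind]
    simp_rw [PMF.map_comp]
    rfl
  have hX : (P.jointLaw k θ).map (fun x => x.1) = θ := by
    rw [jointLaw, PMF.map_bind]
    simp_rw [PMF.map_comp]
    have e : ∀ v : Fin μ, (P.law k v).map ((fun x : Fin μ × Messages F f β k × P.Queries => x.1) ∘
        fun x => (v, x)) = PMF.pure v := fun v => PMF.map_const _ v
    simp_rw [e]
    exact PMF.bind_pure _
  have key : ∀ u y, (((P.law k u).map Y) y).toReal =
      prob (P.jointLaw k θ) (fun x => Y x.2) y := by
    intro u y
    have h2 := h1 u y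
    unfold prob at h2 ⊢
    rw [hmap, hX, bind_map_prodMk_apply, ENNReal.toReal_mul] at h2
    refine mul_left_cancel₀ (ENNReal.toReal_pos ?_ (θ.apply_ne_top u)).ne' h2
    simp [hθ, PMF.uniformOfFintype_apply]
  ext y
  have := (key v y).trans (key v' y).symm
  exact (ENNReal.toReal_eq_toReal_iff' (PMF.apply_ne_top _ y) (PMF.apply_ne_top _ y)).1 this

theorem IsRecoverable.determines {P : Scheme F n f β μ} {G : Matrix (Fin k) (Fin n) F}
    {V : Matrix (Fin μ) (Fin f) F} (h : P.IsRecoverable G V) (v : Fin μ) :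
    Determines (P.law k v) (fun x => (P.reply G x, x.2)) fun x => linFun V x.1 v := by
  have h0 := h v
  unfold condEntropy at h0
  simp_rw [entropy_eq_ent] at h0
  have hlog : Real.log (Fintype.card F) ≠ 0 :=
    (Real.log_pos (by exact_mod_cast Fintype.one_lt_card)).ne'
  refine determines_of_ent_prodMk ?_
  field_simp at h0
  linarith

end Scheme

/-! ### Information sets and linear combinations of messages -/

section LinearAlgebra

variable {F : Type*} [Field F]

theorem linFun_eq_linearCombination {k f β μ : ℕ} (V : Matrix (Fin μ) (Fin f) F)
    (w : Messages F f β k) (v : Fin μ) : linFun V w v = Fintype.linearCombination F w (V v) := by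
  simp [linFun, Fintype.linearCombination_apply]

theorem linearCombination_stored {n k f β : ℕ} (G : Matrix (Fin k) (Fin n) F)
    (w : Messages F f β k) (j : Fin n) (e : Fin f → F) :
    Fintype.linearCombination F (stored G w j) e =
      fun i => (Fintype.linearCombination F w e * G) i j := by
  funext i
  simp only [Fintype.linearCombination_apply, stored, Finset.sum_apply, Pi.smul_apply,
    Matrix.sum_mul, Matrix.sum_apply, Matrix.smul_mul, Matrix.smul_apply]

theorem eq_of_linearCombination_eq {f : ℕ} {N : Type*} [AddCommGroup N] [Module F N]
    {w w' : Fin f → N} {s : Set (Fin f → F)} (hs : Submodule.span F s = ⊤)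
    (h : ∀ e ∈ s, Fintype.linearCombination F w e = Fintype.linearCombination F w' e) : w = w' := by
  have h1 : Fintype.linearCombination F w = Fintype.linearCombination F w' :=
    LinearMap.ext_on hs h
  funext m
  simpa using LinearMap.congr_fun h1 (Pi.single m 1)

theorem exists_span_union_eq_top {f s : ℕ} {u : Fin s → Fin f → F} (hu : LinearIndependent F u) :
    ∃ t : Fin (f - s) → Fin f → F, Submodule.span F (Set.range u ∪ Set.range t) = ⊤ := by
  obtain ⟨C, hC⟩ := Submodule.exists_isCompl (Submodule.span F (Set.range u))
  have hd : Module.finrank F C = f - s := by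
    have h1 := Submodule.finrank_add_eq_of_isCompl hC
    rw [finrank_span_eq_card hu, Module.finrank_fin_fun, Fintype.card_fin] at h1
    omega
  let b := Module.finBasisOfFinrankEq F C hd
  refine ⟨fun i => b i, ?_⟩
  rw [Submodule.span_union, ← hC.sup_eq_top]
  congr 1
  have : Set.range (fun i => (b i : Fin f → F)) = C.subtype '' Set.range b := by
    rw [← Set.range_comp]; rfl
  rw [this, Submodule.span_image, b.span_eq, Submodule.map_subtype_top]

/-- A codeword symbol matrix is recovered from an information set. -/
theorem IsInformationSet.eq_of_mul_eq {k n β : ℕ} {G : Matrix (Fin k) (Fin n) F}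
    {I : Finset (Fin n)} (hI : IsInformationSet G I) {w w' : Matrix (Fin β) (Fin k) F}
    (h : ∀ j ∈ I, ∀ i, (w * G) i j = (w' * G) i j) : w = w' := by
  obtain ⟨e, he⟩ := hI
  set B := G.submatrix id fun i => (e i : Fin n) with hB
  have h1 : w * B = w' * B := by
    ext i l
    exact h (e l) (e l).2 i
  have hdet : IsUnit B.det := (Matrix.isUnit_iff_isUnit_det B).1 he
  calc w = w * B * B⁻¹ := (Matrix.mul_nonsing_inv_cancel_right B w hdet).symm
    _ = w' * B * B⁻¹ := by rw [h1]
    _ = w' := Matrix.mul_nonsing_inv_cancel_right B w' hdet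

theorem IsInformationSet.card_eq {k n : ℕ} {G : Matrix (Fin k) (Fin n) F} {I : Finset (Fin n)}
    (hI : IsInformationSet G I) : I.card = k := by
  obtain ⟨e, -⟩ := hI
  simpa using (Fintype.card_congr e).symm

theorem exists_linearIndependent_rows {f μ r : ℕ} {V : Matrix (Fin μ) (Fin f) F}
    (hV : V.rank = r) : ∃ τ : Fin r → Fin μ, LinearIndependent F fun i => V (τ i) := by
  obtain ⟨κ, a, ha, hspan, hli⟩ := exists_linearIndependent' F V.row
  have : Finite κ := Finite.of_injective a ha
  have : Fintype κ := Fintype.ofFinite κ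
  have hc : Fintype.card κ = r := by
    rw [← finrank_span_eq_card hli, hspan, ← Matrix.rank_eq_finrank_span_row, hV]
  exact ⟨fun i => a ((Fintype.equivFinOfCardEq hc).symm i),
    hli.comp _ (Fintype.equivFinOfCardEq hc).symm.injective⟩

/-- The rows of a rate matrix with `κ / ν = k / n` are supported on information sets. -/
theorem IsMDSPIRCapacityAchieving.exists_informationSets {k n : ℕ} (hk : 0 < k) (hkn : k < n)
    {G : Matrix (Fin k) (Fin n) F} (h : IsMDSPIRCapacityAchieving G) :
    ∃ (κ ν : ℕ) (I : Fin ν → Finset (Fin n)), 0 < κ ∧ κ < ν ∧ κ * n = k * ν ∧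
      (∀ u, IsInformationSet G (I u)) ∧
      ∀ j, (Finset.univ.filter fun u => j ∈ I u).card = κ := by
  obtain ⟨κ, ν, Λ, hν, ⟨hcol, hrow⟩, hrat⟩ := h
  choose I hI hIΛ using hrow
  have hn : 0 < n := hk.trans hkn
  have hmul : κ * n = k * ν := by
    rw [div_eq_div_iff (by positivity) (by positivity)] at hrat
    exact_mod_cast hrat
  have hsub : ∀ u, I u ⊆ Finset.univ.filter fun j => Λ u j = true := fun u j hj => by
    simpa using hIΛ u j hj
  -- Counted by columns, the matrix has κn = kν ones, exactly what ν information sets of size k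
  -- occupy. No row support can therefore exceed its information set.
  have hsum : ∑ u, (Finset.univ.filter fun j => Λ u j = true).card = ∑ u, (I u).card := by
    have h1 : ∑ u, (Finset.univ.filter fun j => Λ u j = true).card =
        ∑ j, (Finset.univ.filter fun u => Λ u j = true).card := by
      simp_rw [Finset.card_filter]
      exact Finset.sum_comm
    rw [h1]
    simp_rw [hcol, (hI _).card_eq]
    simp only [Finset.sum_const, Finset.card_univ, Fintype.card_fin, smul_eq_mul]
    rw [mul_comm n, hmul, mul_comm]
  have heq : ∀ u, I u = Finset.univ.filter fun j => Λ u j = true := by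
    have := (Finset.sum_eq_sum_iff_of_le fun u _ => Finset.card_le_card (hsub u)).1 hsum.symm
    exact fun u => Finset.eq_of_subset_of_card_le (hsub u) (this u (Finset.mem_univ u)).ge
  refine ⟨κ, ν, I, ?_, ?_, hmul, hI, fun j => ?_⟩
  · by_contra h0
    have h0 : κ = 0 := by omega
    rw [h0, zero_mul] at hmul
    exact (Nat.mul_pos hk hν).ne hmul
  · by_contra h0
    have : k * ν < κ * n := by
      calc k * ν < n * ν := Nat.mul_lt_mul_of_pos_right hkn hν
        _ ≤ n * κ := Nat.mul_le_mul_left n (by omega)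
        _ = κ * n := mul_comm _ _
    omega
  · rw [← hcol j]
    congr 1
    ext u
    simp [heq u]

end LinearAlgebra

/-! ### Converse: lower bound on the downloaded information -/

section Converse

variable {F : Type*} [Field F] [Fintype F] {n k f μ β : ℕ}

/-- The contents of the candidate functions `τ 0, …, τ (s - 1)`. -/
def linFuns (V : Matrix (Fin μ) (Fin f) F) (τ : ℕ → Fin μ) (s : ℕ) (w : Messages F f β k) :
    Fin s → Matrix (Fin β) (Fin k) F :=
  fun i => linFun V w (τ i)

namespace Scheme

variable (P : Scheme F n f β μ) (v : Fin μ)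

/-- The candidate functions `τ 0, …, τ (s - 1)`, as a random variable. -/
abbrev funs (V : Matrix (Fin μ) (Fin f) F) (τ : ℕ → Fin μ) (s : ℕ)
    (x : Messages F f β k × P.Queries) : Fin s → Matrix (Fin β) (Fin k) F :=
  linFuns V τ s x.1

theorem ent_funs_le (V : Matrix (Fin μ) (Fin f) F) (τ : ℕ → Fin μ) (s : ℕ) :
    ent (P.law k v) (fun x => (P.funs V τ s x, x.2)) ≤
      (s * (β * k) : ℕ) * Real.log (Fintype.card F) + ent (P.law k v) fun x => x.2 := by
  refine (ent_prodMk_le _ _ _).trans (add_le_add_left ?_ _)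
  rw [← log_card_pi s (card_matrix_eq (F := F) (β := β) (k := k))]
  exact ent_le_log_card _ _

/-- Completing the s independent rows to a spanning family takes f - s further combinations. These
carry at most (f - s)L symbols of the fL in the messages, so the s functions carry the rest, even
jointly with the queries. -/
theorem le_ent_funs {V : Matrix (Fin μ) (Fin f) F} {τ : ℕ → Fin μ} {s : ℕ}
    (hli : LinearIndependent F fun i : Fin s => V (τ i)) :
    (s * (β * k) : ℕ) * Real.log (Fintype.card F) + ent (P.law k v) (fun x => x.2) ≤
      ent (P.law k v) (fun x => (P.funs V τ s x, x.2)) := by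
  obtain ⟨t, ht⟩ := exists_span_union_eq_top hli
  have hs : s ≤ f := by simpa using hli.fintype_card_le_finrank
  let T : Messages F f β k × P.Queries → Fin (f - s) → Matrix (Fin β) (Fin k) F :=
    fun x l => Fintype.linearCombination F x.1 (t l)
  have h1 : ent (P.law k v) T ≤ ((f - s) * (β * k) : ℕ) * Real.log (Fintype.card F) := by
    rw [← log_card_pi (f - s) (card_matrix_eq (F := F) (β := β) (k := k))]
    exact ent_le_log_card _ _
  have h2 : ent (P.law k v) (fun x => (x.1, x.2)) ≤
      ent (P.law k v) fun x => (T x, P.funs V τ s x, x.2) := by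
    refine Determines.ent_le fun x x' _ _ e => ?_
    simp only [Prod.mk.injEq] at e ⊢
    refine ⟨eq_of_linearCombination_eq ht ?_, e.2.2⟩
    rintro _ (⟨i, rfl⟩ | ⟨l, rfl⟩)
    · have := congrFun e.2.1 i
      simpa only [funs, linFuns, linFun_eq_linearCombination] using this
    · exact congrFun e.1 l
  have h3 := ent_prodMk_le (P.law k v) T fun x => (P.funs V τ s x, x.2)
  have h4 := P.ent_law (k := k) v
  have h5 : ((f * (β * k) : ℕ) : ℝ) = (s * (β * k) : ℕ) + ((f - s) * (β * k) : ℕ) := by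
    rw [← Nat.cast_add, ← add_mul, Nat.add_sub_cancel' hs]
  rw [h5] at h4
  linarith

/-- Given the requested function, the answers carry `L` symbols less. -/
theorem le_cent_reply {G : Matrix (Fin k) (Fin n) F} {V : Matrix (Fin μ) (Fin f) F}
    (hrec : P.IsRecoverable G V) {τ : ℕ → Fin μ} {s : ℕ}
    (hli : LinearIndependent F fun i : Fin (s + 1) => V (τ i)) :
    (β * k : ℕ) * Real.log (Fintype.card F) +
        cent (P.law k (τ s)) (P.reply G) (fun x => (P.funs V τ (s + 1) x, x.2)) ≤
      cent (P.law k (τ s)) (P.reply G) (fun x => (P.funs V τ s x, x.2)) := by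
  have h1 := P.le_ent_funs (k := k) (β := β) (τ s) hli
  have h2 := P.ent_funs_le (k := k) (τ s) V τ s
  have h3 : ent (P.law k (τ s)) (fun x => (P.reply G x, P.funs V τ (s + 1) x, x.2)) ≤
      ent (P.law k (τ s)) (fun x => (P.reply G x, P.funs V τ s x, x.2)) := by
    refine Determines.ent_le fun x x' hx hx' e => ?_
    simp only [Prod.mk.injEq] at e ⊢
    refine ⟨e.1, funext fun i => ?_, e.2.2⟩
    rcases Nat.lt_succ_iff_lt_or_eq.1 i.2 with hi | hi
    · exact congrFun e.2.1 ⟨i, hi⟩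
    · have := hrec.determines (τ s) x x' hx hx' (Prod.ext e.1 e.2.2)
      simpa only [funs, linFuns, hi] using this
  have h5 : (((s + 1) * (β * k) : ℕ) : ℝ) = (s * (β * k) : ℕ) + (β * k : ℕ) := by
    push_cast; ring
  rw [h5] at h1
  unfold cent
  linarith

/-- Encoding commutes with combining messages: the given functions fix s independent combinations of
the content of database j, leaving f - s combinations of β symbols each. -/
theorem cent_stored_le (G : Matrix (Fin k) (Fin n) F) {V : Matrix (Fin μ) (Fin f) F}
    {τ : ℕ → Fin μ} {s : ℕ} (hli : LinearIndependent F fun i : Fin s => V (τ i)) (j : Fin n) :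
    cent (P.law k v) (fun x => stored G x.1 j) (fun x => (P.funs V τ s x, x.2 j)) ≤
      ((f - s) * β : ℕ) * Real.log (Fintype.card F) := by
  obtain ⟨t, ht⟩ := exists_span_union_eq_top hli
  let T : Messages F f β k × P.Queries → Fin (f - s) → Fin β → F :=
    fun x l => Fintype.linearCombination F (stored G x.1 j) (t l)
  have h1 : ent (P.law k v) T ≤ ((f - s) * β : ℕ) * Real.log (Fintype.card F) := by
    rw [← log_card_pi (f - s) (N := Fin β → F) (e := β) (by simp)]
    exact ent_le_log_card _ _
  have h2 : ent (P.law k v) (fun x => (stored G x.1 j, P.funs V τ s x, x.2 j)) ≤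
      ent (P.law k v) fun x => (T x, P.funs V τ s x, x.2 j) := by
    refine Determines.ent_le fun x x' _ _ e => ?_
    simp only [Prod.mk.injEq] at e ⊢
    refine ⟨eq_of_linearCombination_eq ht ?_, e.2⟩
    rintro _ (⟨i, rfl⟩ | ⟨l, rfl⟩)
    · have := congrFun e.2.1 i
      simp only [funs, linFuns, linFun_eq_linearCombination] at this
      rw [linearCombination_stored, linearCombination_stored, this]
    · exact congrFun e.1 l
  have h3 := ent_prodMk_le (P.law k v) T fun x => (P.funs V τ s x, x.2 j)
  unfold cent
  linarith

/-- The answers of an information set are conditionally independent. -/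
theorem sum_cent_reply_le {G : Matrix (Fin k) (Fin n) F} {V : Matrix (Fin μ) (Fin f) F}
    {τ : ℕ → Fin μ} {s : ℕ} (hli : LinearIndependent F fun i : Fin s => V (τ i))
    {I : Finset (Fin n)} (hI : IsInformationSet G I) :
    ∑ j ∈ I, cent (P.law k v) (fun x => P.reply G x j) (fun x => (P.funs V τ s x, x.2 j)) ≤
      cent (P.law k v) (P.reply G) (fun x => (P.funs V τ s x, x.2)) := by
  set p := P.law k v with hp
  have hs : s ≤ f := by simpa using hli.fintype_card_le_finrank
  -- The contents on an information set determine the messages. The upper bounds below on the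
  -- entropy of these contents add up to exactly the message entropy, so there is no slack to lose.
  have h1 : ent p (fun x => (x.1, x.2)) ≤
      ent p fun x => ((fun j : I => stored G x.1 j), P.reply G x, P.funs V τ s x, x.2) := by
    refine Determines.ent_le fun x x' _ _ e => ?_
    simp only [Prod.mk.injEq] at e ⊢
    refine ⟨funext fun m => hI.eq_of_mul_eq fun j hj i => ?_, e.2.2.2⟩
    exact congrFun (congrFun (congrFun e.1 ⟨j, hj⟩) m) i
  have h2 := cent_restrict_le p (fun j x => stored G x.1 j)
    (fun x => (P.reply G x, P.funs V τ s x, x.2)) I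
  have h3 : ∀ j ∈ I, cent p (fun x => stored G x.1 j)
      (fun x => (P.reply G x, P.funs V τ s x, x.2)) ≤ ((f - s) * β : ℕ) *
        Real.log (Fintype.card F) -
        cent p (fun x => P.reply G x j) (fun x => (P.funs V τ s x, x.2 j)) := by
    intro j _
    have h4 := P.cent_stored_le v G hli j
    have h5 : cent p (fun x => stored G x.1 j) (fun x => (P.reply G x, P.funs V τ s x, x.2)) ≤
        cent p (fun x => stored G x.1 j) (fun x => (P.reply G x j, P.funs V τ s x, x.2 j)) :=
      cent_le_cent (.of_comp (fun t => (t.1 j, t.2.1, t.2.2 j)) fun _ => rfl)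
    -- The answer is a function of the content and the local query, so knowing it lowers the
    -- uncertainty about the content by the full entropy of the answer.
    have h6 : ent p (fun x => (stored G x.1 j, P.reply G x j, P.funs V τ s x, x.2 j)) ≤
        ent p (fun x => (stored G x.1 j, P.funs V τ s x, x.2 j)) :=
      Determines.ent_le
        (.of_comp (fun t => (t.1, P.answer j t.2.2 t.1, t.2.1, t.2.2)) fun _ => rfl)
    rw [← hp] at h4
    unfold cent at h4 h5 ⊢
    linarith
  have h7 := h2.trans (Finset.sum_le_sum h3)
  rw [Finset.sum_sub_distrib, Finset.sum_const, hI.card_eq, nsmul_eq_mul] at h7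
  have h8 := P.ent_law (k := k) v
  have h9 := P.ent_funs_le (k := k) v V τ s
  rw [← hp] at h8 h9
  have h10 : ((f * (β * k) : ℕ) : ℝ) = (s * (β * k) : ℕ) + k * ((f - s) * β : ℕ) := by
    rw [← Nat.cast_mul, ← Nat.cast_add]
    congr 1
    obtain ⟨d, rfl⟩ := Nat.exists_eq_add_of_le hs
    rw [Nat.add_sub_cancel_left]
    ring
  rw [h10] at h8
  unfold cent at h7 ⊢
  nlinarith [h7, h8, h9, h1]

/-- By privacy, the conditional entropy of a single answer does not depend on the request. -/
theorem IsPrivate.cent_reply_eq {P : Scheme F n f β μ} {G : Matrix (Fin k) (Fin n) F}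
    {V : Matrix (Fin μ) (Fin f) F} (h : P.IsPrivate G V) (v v' : Fin μ) (τ : ℕ → Fin μ) (s : ℕ)
    (j : Fin n) :
    cent (P.law k v) (fun x => P.reply G x j) (fun x => (P.funs V τ s x, x.2 j)) =
      cent (P.law k v') (fun x => P.reply G x j) (fun x => (P.funs V τ s x, x.2 j)) := by
  have h0 := h.map_law_eq j v v'
  unfold cent
  congr 1
  · refine ent_eq_of_map_eq ?_
    have := congrArg (PMF.map fun t => (t.2.1, (fun i : Fin s => t.2.2 (τ i)), t.1)) h0
    rw [PMF.map_comp, PMF.map_comp] at this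
    exact this
  · refine ent_eq_of_map_eq ?_
    have := congrArg (PMF.map fun t => ((fun i : Fin s => t.2.2 (τ i)), t.1)) h0
    rw [PMF.map_comp, PMF.map_comp] at this
    exact this

theorem IsPrivate.ent_reply_eq {P : Scheme F n f β μ} {G : Matrix (Fin k) (Fin n) F}
    {V : Matrix (Fin μ) (Fin f) F} (h : P.IsPrivate G V) (v v' : Fin μ) (j : Fin n) :
    ent (P.law k v) (fun x => P.reply G x j) = ent (P.law k v') (fun x => P.reply G x j) := by
  refine ent_eq_of_map_eq ?_
  have := congrArg (PMF.map fun t => t.2.1) (h.map_law_eq j v v')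
  rw [PMF.map_comp, PMF.map_comp] at this
  exact this

theorem cent_reply_le_sum (G : Matrix (Fin k) (Fin n) F) {γ : Type*} [Fintype γ]
    (Z : Messages F f β k × P.Queries → γ) :
    cent (P.law k v) (P.reply G) Z ≤ ∑ j, cent (P.law k v) (fun x => P.reply G x j) Z := by
  refine le_trans (le_of_eq ?_) (cent_restrict_le (P.law k v) (fun j x => P.reply G x j) Z
    Finset.univ)
  exact cent_congr
    (.of_comp (fun t => ((fun j : (Finset.univ : Finset (Fin n)) => t.1 j), t.2)) fun _ => rfl)
    (.of_comp (fun t => ((fun j => t.1 ⟨j, Finset.mem_univ j⟩), t.2)) fun _ => rfl)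
    (.of_comp id fun _ => rfl) (.of_comp id fun _ => rfl)

variable {P}

/-- The interference bound: changing the request costs a factor `κ / ν`. -/
theorem IsPrivate.mul_cent_reply_le {G : Matrix (Fin k) (Fin n) F} {V : Matrix (Fin μ) (Fin f) F}
    (h : P.IsPrivate G V) {τ : ℕ → Fin μ} {s : ℕ}
    (hli : LinearIndependent F fun i : Fin s => V (τ i)) {κ ν : ℕ} {I : Fin ν → Finset (Fin n)}
    (hI : ∀ u, IsInformationSet G (I u))
    (hcol : ∀ j, (Finset.univ.filter fun u => j ∈ I u).card = κ) (v' : Fin μ) :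
    κ * cent (P.law k v') (P.reply G) (fun x => (P.funs V τ s x, x.2)) ≤
      ν * cent (P.law k v) (P.reply G) (fun x => (P.funs V τ s x, x.2)) := by
  set g : Fin n → ℝ := fun j =>
    cent (P.law k v) (fun x => P.reply G x j) (fun x => (P.funs V τ s x, x.2 j)) with hg
  have h1 : ∑ u, ∑ j ∈ I u, g j ≤
      ν * cent (P.law k v) (P.reply G) (fun x => (P.funs V τ s x, x.2)) := by
    refine (Finset.sum_le_sum fun u _ => P.sum_cent_reply_le v hli (hI u)).trans ?_
    simp
  -- Double counting: each database lies in κ of the information sets.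
  have h2 : ∑ u, ∑ j ∈ I u, g j = κ * ∑ j, g j := by
    have : ∀ u, ∑ j ∈ I u, g j = ∑ j, if j ∈ I u then g j else 0 := fun u => by simp
    simp_rw [this]
    rw [Finset.sum_comm, Finset.mul_sum]
    refine Finset.sum_congr rfl fun j _ => ?_
    rw [← Finset.sum_filter, Finset.sum_const, hcol, nsmul_eq_mul]
  -- Only the local query is kept in each condition, because privacy identifies the two requests for
  -- one database at a time.
  have h3 : cent (P.law k v') (P.reply G) (fun x => (P.funs V τ s x, x.2)) ≤ ∑ j, g j := by
    refine (P.cent_reply_le_sum v' G _).trans (Finset.sum_le_sum fun j _ => ?_)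
    simp only [hg]
    rw [h.cent_reply_eq v v' τ s j]
    exact cent_le_cent (.of_comp (fun t => (t.1, t.2 j)) fun _ => rfl)
  rw [h2] at h1
  exact (mul_le_mul_of_nonneg_left h3 (Nat.cast_nonneg κ)).trans h1

end Scheme

/-- The converse: a lower bound on the downloaded information. -/
theorem Protocol.mul_sum_pow_le {G : Matrix (Fin k) (Fin n) F} {V : Matrix (Fin μ) (Fin f) F}
    (P : Protocol G V β) {r κ ν : ℕ} (hV : V.rank = r) (hν : 0 < ν)
    {I : Fin ν → Finset (Fin n)} (hI : ∀ u, IsInformationSet G (I u))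
    (hcol : ∀ j, (Finset.univ.filter fun u => j ∈ I u).card = κ) (v : Fin μ) :
    (β * k : ℕ) * ∑ i ∈ Finset.range r, ((κ : ℝ) / ν) ^ i ≤
      ∑ j, entropy (Fintype.card F) (P.law k v) (fun x => P.reply G x j) := by
  obtain ⟨τ₀, hτ₀⟩ := exists_linearIndependent_rows hV
  -- The value v beyond r is arbitrary: τ r occurs only as a request at the end of the recursion,
  -- where nonnegativity of entropy suffices.
  let τ : ℕ → Fin μ := fun i => if h : i < r then τ₀ ⟨i, h⟩ else v
  have hli : ∀ s ≤ r, LinearIndependent F fun i : Fin s => V (τ i) := by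
    intro s hs
    have := hτ₀.comp (Fin.castLE hs) (Fin.castLE_injective hs)
    convert this using 2 with i
    have : (i : ℕ) < r := i.2.trans_le hs
    simp [τ, this]
    rfl
  have hlog : 0 < Real.log (Fintype.card F) :=
    Real.log_pos (by exact_mod_cast Fintype.one_lt_card)
  -- Here d counts the functions not yet conditioned on. One step puts T(d+1) = 1 + (κ/ν) T(d): one
  -- unit for the decoded function, and the discounted bound for the next request.
  have key : ∀ d s, s + d = r → (β * k : ℕ) * (∑ i ∈ Finset.range d, ((κ : ℝ) / ν) ^ i) *
      Real.log (Fintype.card F) ≤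
      cent (P.law k (τ s)) (P.reply G) (fun x => (P.funs V τ s x, x.2)) := by
    intro d
    induction d with
    | zero =>
      intro s _
      simpa using cent_nonneg _ _ _
    | succ d ih =>
      intro s hs
      have h1 := ih (s + 1) (by omega)
      have h2 := P.le_cent_reply P.isRecoverable (hli (s + 1) (by omega))
      have h3 := P.isPrivate.mul_cent_reply_le (τ s) (hli (s + 1) (by omega)) hI hcol (τ (s + 1))
      have hν' : (0 : ℝ) < ν := by exact_mod_cast hν
      have h4 : (κ : ℝ) / ν * cent (P.law k (τ (s + 1))) (P.reply G)
          (fun x => (P.funs V τ (s + 1) x, x.2)) ≤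
          cent (P.law k (τ s)) (P.reply G) (fun x => (P.funs V τ (s + 1) x, x.2)) := by
        rw [div_mul_eq_mul_div, div_le_iff₀ hν', mul_comm _ (ν : ℝ)]
        exact h3
      have h5 := mul_le_mul_of_nonneg_left h1 (show (0 : ℝ) ≤ κ / ν by positivity)
      refine le_trans (le_of_eq ?_) ((add_le_add_right (h5.trans h4) _).trans h2)
      rw [Finset.sum_range_succ', pow_zero]
      simp_rw [pow_succ']
      rw [← Finset.mul_sum]
      ring
  have h1 := key r 0 (zero_add r)
  have h2 := P.cent_reply_le_sum (k := k) (τ 0) G fun x => (P.funs V τ 0 x, x.2)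
  have h3 := Finset.sum_le_sum fun j (_ : j ∈ Finset.univ) =>
    (cent_le_ent (P.law k (τ 0)) (fun x => P.reply G x j) fun x => (P.funs V τ 0 x, x.2)).trans
      (P.isPrivate.ent_reply_eq (τ 0) v j).le
  simp_rw [entropy_eq_ent]
  rw [← Finset.sum_div, le_div_iff₀ hlog]
  exact h1.trans (h2.trans h3)

end Converse

/-! ### Alternating forms on F × B: restriction, contraction and alternation -/

section AlternatingForms

variable {F : Type*} [Field F]

/-- Precomposition with a linear map, as a linear map between spaces of alternating forms. -/
def compLinearMapLM {E E' : Type*} [AddCommGroup E] [Module F E] [AddCommGroup E'] [Module F E']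
    (g : E' →ₗ[F] E) (i : ℕ) : (E [⋀^Fin i]→ₗ[F] F) →ₗ[F] (E' [⋀^Fin i]→ₗ[F] F) where
  toFun z := z.compLinearMap g
  map_add' _ _ := rfl
  map_smul' _ _ := rfl

theorem compLinearMapLM_apply {E E' : Type*} [AddCommGroup E] [Module F E] [AddCommGroup E']
    [Module F E'] (g : E' →ₗ[F] E) (i : ℕ) (z : E [⋀^Fin i]→ₗ[F] F) (v : Fin i → E') :
    compLinearMapLM g i z v = z fun p => g (v p) := rfl

section Finrank

variable (F) (E : Type*) [AddCommGroup E] [Module F E] [Module.Finite F E] (i : ℕ)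

instance finite_alternatingForms : Module.Finite F (E [⋀^Fin i]→ₗ[F] F) :=
  Module.Finite.equiv (exteriorPower.alternatingMapLinearEquiv (R := F) (n := i) (M := E)
    (N := F)).symm

theorem finrank_alternatingForms :
    Module.finrank F (E [⋀^Fin i]→ₗ[F] F) = (Module.finrank F E).choose i := by
  rw [(exteriorPower.alternatingMapLinearEquiv (R := F) (n := i) (M := E) (N := F)).finrank_eq,
    ← exteriorPower.finrank_eq F i (M := E)]
  exact Subspace.dual_finrank_eq

end Finrank

theorem alternatizeUncurryFin_compLinearMap {E E' : Type*} [AddCommGroup E] [Module F E]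
    [AddCommGroup E'] [Module F E'] {i : ℕ} (L : E →ₗ[F] E [⋀^Fin i]→ₗ[F] F) (g : E' →ₗ[F] E) :
    (AlternatingMap.alternatizeUncurryFin L).compLinearMap g =
      AlternatingMap.alternatizeUncurryFin (compLinearMapLM g i ∘ₗ L ∘ₗ g) := by
  ext v
  rw [AlternatingMap.compLinearMap_apply, AlternatingMap.alternatizeUncurryFin_apply,
    AlternatingMap.alternatizeUncurryFin_apply]
  rfl

variable {B : Type*} [AddCommGroup B] [Module F B]

/-- Restriction of an alternating form on `F × B` to `B`. -/
abbrev res (i : ℕ) : ((F × B) [⋀^Fin i]→ₗ[F] F) →ₗ[F] (B [⋀^Fin i]→ₗ[F] F) :=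
  compLinearMapLM (LinearMap.inr F F B) i

/-- Contraction of an alternating form on `F × B` with `(1, 0)`, restricted to `B`. -/
def con (i : ℕ) : ((F × B) [⋀^Fin (i + 1)]→ₗ[F] F) →ₗ[F] (B [⋀^Fin i]→ₗ[F] F) :=
  res i ∘ₗ (LinearMap.applyₗ ((1 : F), (0 : B))) ∘ₗ AlternatingMap.curryLeftLinearMap

theorem con_apply {i : ℕ} (z : (F × B) [⋀^Fin (i + 1)]→ₗ[F] F) (v : Fin i → B) :
    con i z v = z (Matrix.vecCons (1, 0) fun p => (0, v p)) := rfl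

/-- The alternating form on `F × B` with given restriction and contraction. -/
def assemble (i : ℕ) : ((B [⋀^Fin (i + 1)]→ₗ[F] F) × (B [⋀^Fin i]→ₗ[F] F)) →ₗ[F]
    ((F × B) [⋀^Fin (i + 1)]→ₗ[F] F) :=
  (compLinearMapLM (LinearMap.snd F F B) (i + 1)).coprod
    (AlternatingMap.alternatizeUncurryFinLM ∘ₗ LinearMap.smulRightₗ (LinearMap.fst F F B) ∘ₗ
      compLinearMapLM (LinearMap.snd F F B) i)

theorem assemble_apply {i : ℕ} (ψ : B [⋀^Fin (i + 1)]→ₗ[F] F) (ψ' : B [⋀^Fin i]→ₗ[F] F)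
    (v : Fin (i + 1) → F × B) :
    assemble i (ψ, ψ') v = ψ (fun p => (v p).2) +
      ∑ p : Fin (i + 1), (-1) ^ (p : ℕ) • ((v p).1 • ψ' fun q => (p.removeNth v q).2) := by
  have : assemble i (ψ, ψ') v = ψ (fun p => (v p).2) +
    AlternatingMap.alternatizeUncurryFin ((LinearMap.fst F F B).smulRight
        (compLinearMapLM (LinearMap.snd F F B) i ψ')) v := rfl
  rw [this, AlternatingMap.alternatizeUncurryFin_apply]
  rfl

theorem res_assemble {i : ℕ} (ψ : B [⋀^Fin (i + 1)]→ₗ[F] F) (ψ' : B [⋀^Fin i]→ₗ[F] F) :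
    res (i + 1) (assemble i (ψ, ψ')) = ψ := by
  ext v
  rw [compLinearMapLM_apply, assemble_apply]
  simp

theorem con_assemble {i : ℕ} (ψ : B [⋀^Fin (i + 1)]→ₗ[F] F) (ψ' : B [⋀^Fin i]→ₗ[F] F) :
    con i (assemble i (ψ, ψ')) = ψ' := by
  ext v
  rw [con_apply, assemble_apply, AlternatingMap.map_coord_zero ψ 0 (by simp), Fin.sum_univ_succ]
  simp only [Matrix.cons_val_succ, zero_smul, smul_zero, Finset.sum_const_zero, add_zero, zero_add]
  simp [Fin.removeNth]

theorem eq_of_res_zero {z z' : (F × B) [⋀^Fin 0]→ₗ[F] F} (h : res 0 z = res 0 z') : z = z' := by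
  ext v
  have := AlternatingMap.congr_fun h Fin.elim0
  rw [compLinearMapLM_apply, compLinearMapLM_apply] at this
  convert this

/-- An alternating form is determined on injective tuples of basis vectors. Such a tuple contains
(1, 0) at most once: if present, it is moved to the front and the contraction decides; otherwise the
restriction does. -/
theorem eq_of_res_con {i : ℕ} {z z' : (F × B) [⋀^Fin (i + 1)]→ₗ[F] F}
    (h : res (i + 1) z = res (i + 1) z') (h' : con i z = con i z') : z = z' := by
  let b := (Module.Basis.singleton Unit F).prod (Module.Basis.ofVectorSpace F B)
  refine b.ext_alternating fun v hv => ?_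
  by_cases h0 : ∃ p, v p = Sum.inl ()
  · obtain ⟨p, hp⟩ := h0
    have hb : (fun q => b (v q)) = p.insertNth (1, 0)
        fun q => (0, (b (v (p.succAbove q))).2) := by
      rw [Fin.eq_insertNth_iff]
      refine ⟨by simp [b, hp], funext fun q => ?_⟩
      have hq : v (p.succAbove q) ≠ Sum.inl () := fun e =>
        Fin.succAbove_ne p q (hv (e.trans hp.symm))
      cases hvq : v (p.succAbove q) with
      | inl x => exact absurd hvq hq
      | inr x => simp [b, Fin.removeNth, hvq]
    have := AlternatingMap.congr_fun h' fun q => (b (v (p.succAbove q))).2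
    rw [con_apply, con_apply] at this
    rw [hb, AlternatingMap.map_insertNth, AlternatingMap.map_insertNth, this]
  · have hb : (fun q => b (v q)) = fun q => (0, (b (v q)).2) := by
      funext q
      cases hvq : v q with
      | inl x => exact absurd ⟨q, hvq⟩ h0
      | inr x => simp [b]
    have := AlternatingMap.congr_fun h fun q => (b (v q)).2
    rw [compLinearMapLM_apply, compLinearMapLM_apply] at this
    rw [hb]
    exact this

theorem res_alternatizeUncurryFin {i : ℕ} (L : (F × B) →ₗ[F] (F × B) [⋀^Fin i]→ₗ[F] F) :
    res (i + 1) (AlternatingMap.alternatizeUncurryFin L) =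
      AlternatingMap.alternatizeUncurryFin (res i ∘ₗ L ∘ₗ LinearMap.inr F F B) :=
  alternatizeUncurryFin_compLinearMap L _

theorem con_alternatizeUncurryFin_zero (L : (F × B) →ₗ[F] (F × B) [⋀^Fin 0]→ₗ[F] F) :
    con 0 (AlternatingMap.alternatizeUncurryFin L) = res 0 (L (1, 0)) := by
  ext v
  rw [con_apply, AlternatingMap.alternatizeUncurryFin_apply, compLinearMapLM_apply]
  simp only [Fin.sum_univ_succ, Finset.univ_eq_empty, Finset.sum_empty, add_zero]
  simp

/-- The identity behind decoding. Expanding the alternation with (1, 0) in front, the first term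
exposes the desired value L (1, 0), while the others assemble, with opposite sign, into an
alternation over B alone: the interference. -/
theorem con_alternatizeUncurryFin_succ {i : ℕ}
    (L : (F × B) →ₗ[F] (F × B) [⋀^Fin (i + 1)]→ₗ[F] F) :
    con (i + 1) (AlternatingMap.alternatizeUncurryFin L) = res (i + 1) (L (1, 0)) -
      AlternatingMap.alternatizeUncurryFin (con i ∘ₗ L ∘ₗ LinearMap.inr F F B) := by
  ext v
  rw [con_apply, AlternatingMap.alternatizeUncurryFin_apply, AlternatingMap.sub_apply,
    compLinearMapLM_apply, AlternatingMap.alternatizeUncurryFin_apply, Fin.sum_univ_succ,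
    sub_eq_add_neg, ← Finset.sum_neg_distrib]
  congr 1
  · simp
  · refine Finset.sum_congr rfl fun p _ => ?_
    have : p.succ.removeNth (Matrix.vecCons ((1 : F), (0 : B)) fun q => ((0 : F), v q)) =
        Matrix.vecCons (1, 0) fun q => (0, p.removeNth v q) := by
      funext q
      refine Fin.cases ?_ (fun q => ?_) q <;> simp [Fin.removeNth]
    rw [this, Fin.val_succ, pow_succ]
    simp only [LinearMap.comp_apply, con_apply, Matrix.cons_val_succ, LinearMap.inr_apply]
    simp

end AlternatingForms

/-! ### Surjections, uniform laws and decoding in modules -/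

section Linear

variable {F : Type*} [Field F]

/-- Surjections of a finite-dimensional space onto the same space are equivalent. -/
theorem exists_linearEquiv_comp_eq {A Z : Type*} [AddCommGroup A] [Module F A] [Module.Finite F A]
    [AddCommGroup Z] [Module F Z] {T T' : A →ₗ[F] Z} (hT : Function.Surjective T)
    (hT' : Function.Surjective T') : ∃ h : A ≃ₗ[F] A, ∀ x, T' x = T (h x) := by
  -- A section of T splits A as kernel times Z with T as second projection; the kernels of the two
  -- surjections have equal dimension.
  have key : ∀ T : A →ₗ[F] Z, Function.Surjective T →
      ∃ e : (LinearMap.ker T × Z) ≃ₗ[F] A, ∀ x, T (e x) = x.2 := by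
    intro T hT
    obtain ⟨s, hs⟩ := T.exists_rightInverse_of_surjective (LinearMap.range_eq_top.2 hT)
    have hs' : ∀ z, T (s z) = z := LinearMap.congr_fun hs
    have hT' : ∀ x : LinearMap.ker T × Z, T (x.1 + s x.2) = x.2 := fun x => by
      rw [map_add, hs', LinearMap.mem_ker.1 x.1.2, zero_add]
    refine ⟨LinearEquiv.ofBijective ((LinearMap.ker T).subtype.coprod s) ⟨?_, ?_⟩, ?_⟩
    · rintro ⟨a, z⟩ ⟨a', z'⟩ h
      have h' : (a : A) + s z = a' + s z' := h
      have h1 : z = z' := by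
        exact (hT' (a, z)).symm.trans ((congrArg T h').trans (hT' (a', z')))
      subst h1
      exact Prod.ext (Subtype.ext (add_right_cancel h')) rfl
    · intro a
      refine ⟨(⟨a - s (T a), by rw [LinearMap.mem_ker, map_sub, hs', sub_self]⟩, T a), ?_⟩
      simp
    · exact hT'
  obtain ⟨e, he⟩ := key T hT
  obtain ⟨e', he'⟩ := key T' hT'
  have hd : Module.finrank F (LinearMap.ker T) = Module.finrank F (LinearMap.ker T') := by
    have h1 := T.finrank_range_add_finrank_ker
    have h2 := T'.finrank_range_add_finrank_ker
    rw [LinearMap.range_eq_top.2 hT] at h1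
    rw [LinearMap.range_eq_top.2 hT'] at h2
    omega
  refine ⟨e'.symm ≪≫ₗ (LinearEquiv.ofFinrankEq _ _ hd.symm).prodCongr (.refl F Z) ≪≫ₗ e,
    fun x => ?_⟩
  simp only [LinearEquiv.trans_apply]
  rw [he]
  conv_lhs => rw [← e'.apply_symm_apply x]
  rw [he']
  rfl

theorem map_uniformOfFintype_equiv {α : Type*} [Fintype α] [Nonempty α] (e : α ≃ α) :
    (PMF.uniformOfFintype α).map e = PMF.uniformOfFintype α := by
  ext a
  rw [PMF.map_apply, tsum_eq_single (e.symm a)]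
  · simp
  · intro b hb
    rw [if_neg]
    rintro rfl
    simp at hb

/-- An element of an `F`-module is recovered from the code symbols in an information set. -/
theorem IsInformationSet.eq_zero_of_sum_smul {k n : ℕ} {G : Matrix (Fin k) (Fin n) F}
    {I : Finset (Fin n)} (hI : IsInformationSet G I) {N : Type*} [AddCommGroup N] [Module F N]
    {a : Fin k → N} (h : ∀ j ∈ I, ∑ l, G l j • a l = 0) : a = 0 := by
  obtain ⟨e, he⟩ := hI
  set B := G.submatrix id fun i => (e i : Fin n) with hB
  have hdet : IsUnit B.det := (Matrix.isUnit_iff_isUnit_det B).1 he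
  funext l
  have h1 : ∀ i, ∑ l, B l i • a l = 0 := fun i => h (e i) (e i).2
  have h2 : ∑ i, B⁻¹ i l • ∑ l', B l' i • a l' = a l := by
    simp_rw [Finset.smul_sum, smul_smul]
    rw [Finset.sum_comm]
    simp_rw [← Finset.sum_smul]
    have : ∀ l', ∑ i, B⁻¹ i l * B l' i = if l' = l then 1 else 0 := fun l' => by
      rw [← Matrix.one_apply, ← Matrix.mul_nonsing_inv B hdet, Matrix.mul_apply]
      exact Finset.sum_congr rfl fun i _ => mul_comm _ _
    simp [this]
  rw [← h2]
  simp [h1]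

end Linear

/-! ### Shares of the databases and decoding -/

section Shares

variable {F : Type*} [Field F] {B : Type*} [AddCommGroup B] [Module F B] {n k d ν : ℕ}
  {I : Fin ν → Finset (Fin n)} {c : ℕ → ℕ}

/-- Families of alternating forms on `B`: in degree `i`, there are `c i` forms for every
information set. -/
abbrev Blocks (F B : Type*) [Field F] [AddCommGroup B] [Module F B] (d ν : ℕ) (c : ℕ → ℕ) :
    Type _ :=
  ∀ i : Fin (d + 1), Fin ν × Fin (c i) → (B [⋀^Fin i]→ₗ[F] F)

/-- Families of alternating forms on `E`: in degree `i`, there are `c i` forms for every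
information set which contains the coordinate `j`. -/
abbrev Shares (F E : Type*) [Field F] [AddCommGroup E] [Module F E] (d : ℕ) {ν n : ℕ}
    (I : Fin ν → Finset (Fin n)) (c : ℕ → ℕ) (j : Fin n) : Type _ :=
  ∀ i : Fin (d + 1), {u // j ∈ I u} × Fin (c i) → (E [⋀^Fin i]→ₗ[F] F)

/-- The families in which the answer of database `j` lies. -/
abbrev Responses (F E : Type*) [Field F] [AddCommGroup E] [Module F E] (d : ℕ) {ν n : ℕ}
    (I : Fin ν → Finset (Fin n)) (c : ℕ → ℕ) (j : Fin n) : Type _ :=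
  ∀ i : Fin (d + 1), {u // j ∈ I u} × Fin (c i) → (E [⋀^Fin (i + 1)]→ₗ[F] F)

/-- Pairings, at every database, of the forms of degree `i + 1` of the information sets which
contain it with the forms of degree `i` of the other information sets. -/
abbrev Pairings (d : ℕ) {ν n : ℕ} (I : Fin ν → Finset (Fin n)) (c : ℕ → ℕ) : Type :=
  ∀ (j : Fin n) (i : ℕ), i < d →
    ({u // j ∈ I u} × Fin (c (i + 1)) ≃ {u // j ∉ I u} × Fin (c i))

/-- The forms on `F × B` which are sent to database `j`: their restrictions to `B` are the blocks
of the information sets which contain `j`, and their contractions are the blocks of the others. -/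
def share (σ : Pairings d I c) (j : Fin n) : ∀ (i : Fin (d + 1)) (_ : {u // j ∈ I u} × Fin (c i)),
    Blocks F B d ν c →ₗ[F] ((F × B) [⋀^Fin i]→ₗ[F] F)
  | ⟨0, h⟩, x => compLinearMapLM (LinearMap.snd F F B) 0 ∘ₗ
      LinearMap.proj (x.1.1, x.2) ∘ₗ LinearMap.proj ⟨0, h⟩
  | ⟨i + 1, h⟩, x => assemble i ∘ₗ LinearMap.prod
      (LinearMap.proj (x.1.1, x.2) ∘ₗ LinearMap.proj ⟨i + 1, h⟩)
      (LinearMap.proj ((σ j i (Nat.lt_of_succ_lt_succ h) x).1.1,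
          (σ j i (Nat.lt_of_succ_lt_succ h) x).2) ∘ₗ
        LinearMap.proj (⟨i, Nat.lt_of_succ_lt h⟩ : Fin (d + 1)))

theorem res_share (σ : Pairings d I c) (j : Fin n) (i : Fin (d + 1))
    (x : {u // j ∈ I u} × Fin (c i)) (ψ : Blocks F B d ν c) :
    res i (share σ j i x ψ) = ψ i (x.1, x.2) := by
  obtain ⟨_ | i, h⟩ := i
  · rfl
  · exact res_assemble _ _

theorem con_share (σ : Pairings d I c) (j : Fin n) {i : ℕ} (h : i + 1 < d + 1)
    (x : {u // j ∈ I u} × Fin (c (i + 1))) (ψ : Blocks F B d ν c) :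
    con i (share σ j ⟨i + 1, h⟩ x ψ) = ψ ⟨i, Nat.lt_of_succ_lt h⟩
      ((σ j i (Nat.lt_of_succ_lt_succ h) x).1, (σ j i (Nat.lt_of_succ_lt_succ h) x).2) :=
  con_assemble _ _

/-- Since σ is a bijection, each block appears in at most one share of j, as a restriction or as a
contraction, so all can be prescribed freely. Blocks of degree d of information sets avoiding j are
never seen there and are set to zero. -/
theorem exists_share_eq (σ : Pairings d I c) (j : Fin n) (χ : Shares F (F × B) d I c j) :
    ∃ ψ : Blocks F B d ν c, ∀ i x, share σ j i x ψ = χ i x := by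
  classical
  let ψ : Blocks F B d ν c := fun i y =>
    if h : j ∈ I y.1 then res i (χ i (⟨y.1, h⟩, y.2))
    else if hi : (i : ℕ) < d then
      con i (χ ⟨i + 1, Nat.succ_lt_succ hi⟩ ((σ j i hi).symm (⟨y.1, h⟩, y.2)))
    else 0
  refine ⟨ψ, fun i x => ?_⟩
  have hr : res i (share σ j i x ψ) = res i (χ i x) := by
    rw [res_share]
    exact dif_pos x.1.2
  obtain ⟨_ | i, h⟩ := i
  · exact eq_of_res_zero hr
  · refine eq_of_res_con hr ?_
    rw [con_share]
    have h1 : j ∉ I ((σ j i (Nat.lt_of_succ_lt_succ h) x).1 : Fin ν) :=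
      (σ j i (Nat.lt_of_succ_lt_succ h) x).1.2
    simp only [ψ]
    rw [dif_neg h1, dif_pos (Nat.lt_of_succ_lt_succ h)]
    simp

/-- Zero answers come from a zero requested function. -/
theorem eq_zero_of_share_answers {G : Matrix (Fin k) (Fin n) F}
    (hI : ∀ u, IsInformationSet G (I u)) (σ : Pairings d I c) {U : Type*} [AddCommGroup U]
    [Module F U] (Ψ : U ≃ₗ[F] Blocks F B d ν c) (y : Fin k → (F × B) →ₗ[F] U)
    (h : ∀ j i x, AlternatingMap.alternatizeUncurryFin
      ((share σ j i x ∘ₗ Ψ.toLinearMap) ∘ₗ ∑ l, G l j • y l) = 0) (l : Fin k) :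
    y l (1, 0) = 0 := by
  let φ : ∀ (i : Fin (d + 1)) (_ : Fin ν × Fin (c i)), U →ₗ[F] (B [⋀^Fin i]→ₗ[F] F) := fun i p =>
    LinearMap.proj p ∘ₗ LinearMap.proj i ∘ₗ Ψ.toLinearMap
  have hsum : ∀ i p j, AlternatingMap.alternatizeUncurryFin
      (φ i p ∘ₗ (∑ l, G l j • y l) ∘ₗ LinearMap.inr F F B) =
      ∑ l, G l j • AlternatingMap.alternatizeUncurryFin (φ i p ∘ₗ y l ∘ₗ LinearMap.inr F F B) := by
    intro i p j
    have : φ i p ∘ₗ (∑ l, G l j • y l) ∘ₗ LinearMap.inr F F B =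
        ∑ l, G l j • (φ i p ∘ₗ y l ∘ₗ LinearMap.inr F F B) := by
      ext b : 1
      simp [LinearMap.sum_apply, map_sum]
    rw [this]
    have := map_sum (AlternatingMap.alternatizeUncurryFinLM (R := F) (M := B) (N := F) (n := i))
      (fun l => G l j • (φ i p ∘ₗ y l ∘ₗ LinearMap.inr F F B)) Finset.univ
    refine this.trans (Finset.sum_congr rfl fun l _ => ?_)
    exact map_smul AlternatingMap.alternatizeUncurryFinLM _ _
  -- Interference first: for each block, its alternations over B are code symbols. They vanish on
  -- the information set of the block, hence for every l, and so also at the databases outside that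
  -- set.
  have h1 : ∀ i p l, AlternatingMap.alternatizeUncurryFin
      (φ i p ∘ₗ y l ∘ₗ LinearMap.inr F F B) = 0 := by
    intro i p
    refine congrFun ((hI p.1).eq_zero_of_sum_smul fun j hj => ?_)
    rw [← hsum]
    have h2 := congrArg (res (i + 1)) (h j i (⟨p.1, hj⟩, p.2))
    rw [res_alternatizeUncurryFin, map_zero] at h2
    rw [← h2]
    congr 1
    ext b : 1
    exact (res_share σ j i (⟨p.1, hj⟩, p.2) _).symm
  -- After contraction, the interference at j comes from a block whose information set avoids j, and
  -- it is zero by `h1`. The desired values then vanish on the information set of p, and a second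
  -- decoding applies.
  have h2 : ∀ i p, (fun l => φ i p (y l (1, 0))) = 0 := by
    intro i p
    refine (hI p.1).eq_zero_of_sum_smul fun j hj => ?_
    have h4 : ∑ l, G l j • φ i p (y l (1, 0)) = φ i p ((∑ l, G l j • y l) (1, 0)) := by
      simp [LinearMap.sum_apply, map_sum]
    rw [h4]
    have h3 := h j i (⟨p.1, hj⟩, p.2)
    have h5 := res_share σ j i (⟨p.1, hj⟩, p.2) (Ψ ((∑ l, G l j • y l) (1, 0)))
    refine h5.symm.trans ?_
    obtain ⟨_ | i, hi⟩ := i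
    · have h6 := congrArg (con 0) h3
      rw [map_zero] at h6
      exact (con_alternatizeUncurryFin_zero _).symm.trans h6
    · have h6 := congrArg (con (i + 1)) h3
      rw [map_zero] at h6
      have h7 := (con_alternatizeUncurryFin_succ _).symm.trans h6
      rw [sub_eq_zero] at h7
      refine h7.trans ?_
      set q := σ j i (Nat.lt_of_succ_lt_succ hi) (⟨p.1, hj⟩, p.2)
      have h8 := hsum ⟨i, Nat.lt_of_succ_lt hi⟩ (q.1, q.2) j
      simp only [h1, smul_zero, Finset.sum_const_zero] at h8
      rw [← h8]
      congr 1
      ext b : 1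
      exact con_share σ j hi (⟨p.1, hj⟩, p.2) _
  refine Ψ.map_eq_zero_iff.1 ?_
  funext i p
  exact congrFun (h2 i p) l

end Shares

/-! ### Sufficient conditions for privacy and recovery -/

namespace Scheme

variable {F : Type*} [Field F] [Fintype F] {n f β μ k : ℕ}

/-- A scheme is private if the law of every single query does not depend on the request. -/
theorem isPrivate_of_map_queryLaw_eq {P : Scheme F n f β μ} (G : Matrix (Fin k) (Fin n) F)
    (V : Matrix (Fin μ) (Fin f) F)
    (h : ∀ j v v', (P.queryLaw v).map (fun q => q j) = (P.queryLaw v').map fun q => q j) :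
    P.IsPrivate G V := by
  intro θ j
  set Y : Messages F f β k × P.Queries → _ := fun x => (x.2 j, P.reply G x j, linFun V x.1) with hY
  have hlaw : ∀ v, (P.law k v).map Y = (PMF.uniformOfFintype (Messages F f β k)).bind fun w =>
      ((P.queryLaw v).map fun q => q j).map
        fun q => (q, P.answer j q (stored G w j), linFun V w) := by
    intro v
    rw [law, PMF.map_bind]
    simp_rw [PMF.map_comp]
    rfl
  obtain ⟨v₀, -⟩ := θ.support_nonempty
  have hmap : (P.jointLaw k θ).map (fun x => (x.1, Y x.2)) =
      θ.bind fun v => ((P.law k v₀).map Y).map fun y => (v, y) := by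
    rw [jointLaw, PMF.map_bind]
    congr 1
    funext v
    rw [hlaw v₀, h j v₀ v, ← hlaw v, PMF.map_comp, PMF.map_comp]
    rfl
  have h1 := ent_prodMk_of_indep (indep_of_bind_map hmap)
  unfold mutualInfo
  simp_rw [entropy_eq_ent]
  rw [h1]
  ring

/-- A scheme is recoverable if the answers to queries of positive probability determine the
requested function. -/
theorem isRecoverable_of_forall {P : Scheme F n f β μ} {G : Matrix (Fin k) (Fin n) F}
    {V : Matrix (Fin μ) (Fin f) F}
    (h : ∀ v, ∀ q ∈ (P.queryLaw v).support, ∀ w w' : Messages F f β k,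
      P.reply G (w, q) = P.reply G (w', q) → linFun V w v = linFun V w' v) :
    P.IsRecoverable G V := by
  intro v
  have hd : Determines (P.law k v) (fun x => (P.reply G x, x.2))
      fun x => (linFun V x.1 v, P.reply G x, x.2) := by
    rintro ⟨w, q⟩ ⟨w', q'⟩ hx - e
    simp only [Prod.mk.injEq] at e ⊢
    obtain ⟨e1, rfl⟩ := e
    refine ⟨h v q ?_ w w' e1, e1, rfl⟩
    rw [law_apply] at hx
    exact (PMF.mem_support_iff _ _).2 (right_ne_zero_of_mul hx)
  unfold condEntropy
  simp_rw [entropy_eq_ent]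
  rw [sub_eq_zero, hd.ent_eq (.of_comp Prod.snd fun _ => rfl)]

end Scheme

/-! ### The alternating scheme -/

section Construction

variable {F : Type*} [Field F] {B : Type*} [AddCommGroup B] [Module F B]
  {E : Type*} [AddCommGroup E] [Module F E] {n k d ν f β μ : ℕ}
  {I : Fin ν → Finset (Fin n)} {c : ℕ → ℕ}

/-- The forms sent to database `j`, transported along an isomorphism `F × B ≃ E`. -/
def shareMap (σ : Pairings d I c) (η : (F × B) ≃ₗ[F] E) (j : Fin n) :
    Blocks F B d ν c →ₗ[F] Shares F E d I c j :=
  LinearMap.pi fun i => LinearMap.pi fun x =>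
    compLinearMapLM η.symm.toLinearMap i ∘ₗ share σ j i x

theorem compLinearMapLM_symm (η : (F × B) ≃ₗ[F] E) (i : ℕ) (z : (F × B) [⋀^Fin i]→ₗ[F] F) :
    compLinearMapLM η.toLinearMap i (compLinearMapLM η.symm.toLinearMap i z) = z := by
  ext v
  simp [compLinearMapLM_apply]

theorem compLinearMapLM_symm' (η : (F × B) ≃ₗ[F] E) (i : ℕ) (z : E [⋀^Fin i]→ₗ[F] F) :
    compLinearMapLM η.symm.toLinearMap i (compLinearMapLM η.toLinearMap i z) = z := by
  ext v
  simp [compLinearMapLM_apply]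

theorem shareMap_surjective (σ : Pairings d I c) (η : (F × B) ≃ₗ[F] E) (j : Fin n) :
    Function.Surjective (shareMap σ η j) := by
  intro χ
  obtain ⟨ψ, hψ⟩ := exists_share_eq σ j fun i x => compLinearMapLM η.toLinearMap i (χ i x)
  refine ⟨ψ, ?_⟩
  funext i x
  change compLinearMapLM η.symm.toLinearMap i (share σ j i x ψ) = χ i x
  rw [hψ, compLinearMapLM_symm']

/-- The answer of database `j` with content `y` to the query `A`: the alternations of the forms
of the query evaluated at the content. -/
def respond (ι : E →ₗ[F] Fin f → F) (j : Fin n) (A : (Fin β → F) →ₗ[F] Shares F E d I c j)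
    (y : Fin f → Fin β → F) : Responses F E d I c j := fun i x =>
  AlternatingMap.alternatizeUncurryFin
    ((LinearMap.proj x ∘ₗ LinearMap.proj i ∘ₗ A) ∘ₗ Fintype.linearCombination F y ∘ₗ ι)

theorem linearCombination_sub {N : Type*} [AddCommGroup N] [Module F N] (w w' : Fin f → N) :
    Fintype.linearCombination F (w - w') =
      Fintype.linearCombination F w - Fintype.linearCombination F w' :=
  LinearMap.ext fun e => by
    simp [Fintype.linearCombination_apply, smul_sub, Finset.sum_sub_distrib]

theorem respond_sub (ι : E →ₗ[F] Fin f → F) (j : Fin n)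
    (A : (Fin β → F) →ₗ[F] Shares F E d I c j) (y y' : Fin f → Fin β → F) :
    respond ι j A (y - y') = respond ι j A y - respond ι j A y' := by
  funext i x
  change AlternatingMap.alternatizeUncurryFin _ = AlternatingMap.alternatizeUncurryFin _ -
    AlternatingMap.alternatizeUncurryFin _
  rw [linearCombination_sub, LinearMap.sub_comp, LinearMap.comp_sub]
  exact map_sub (AlternatingMap.alternatizeUncurryFinLM (R := F) (M := E) (N := F) (n := (i : ℕ)))
    _ _

theorem stored_sub (G : Matrix (Fin k) (Fin n) F) (w w' : Messages F f β k) (j : Fin n) :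
    stored G (w - w') j = stored G w j - stored G w' j := by
  funext m i
  simp [stored, Matrix.sub_mul]

/-- Equal answers of all databases come from equal values of the requested function. -/
theorem linearCombination_eq_of_respond_eq {G : Matrix (Fin k) (Fin n) F}
    (hI : ∀ u, IsInformationSet G (I u)) (σ : Pairings d I c) (ι : E →ₗ[F] Fin f → F)
    (η : (F × B) ≃ₗ[F] E) (Ψ : (Fin β → F) ≃ₗ[F] Blocks F B d ν c) {w w' : Messages F f β k}
    (h : ∀ j, respond ι j (shareMap σ η j ∘ₗ Ψ.toLinearMap) (stored G w j) =
      respond ι j (shareMap σ η j ∘ₗ Ψ.toLinearMap) (stored G w' j)) :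
    Fintype.linearCombination F w (ι (η (1, 0))) =
      Fintype.linearCombination F w' (ι (η (1, 0))) := by
  let col : Fin k → Matrix (Fin β) (Fin k) F →ₗ[F] (Fin β → F) := fun l =>
    LinearMap.pi fun t => Matrix.entryLinearMap F F t l
  let y : Fin k → (F × B) →ₗ[F] (Fin β → F) := fun l =>
    col l ∘ₗ Fintype.linearCombination F (w - w') ∘ₗ ι ∘ₗ η.toLinearMap
  have hy : ∀ j, ∑ l, G l j • y l =
      Fintype.linearCombination F (stored G (w - w') j) ∘ₗ ι ∘ₗ η.toLinearMap := by
    intro j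
    refine LinearMap.ext fun e => ?_
    rw [LinearMap.comp_apply, linearCombination_stored]
    funext t
    rw [LinearMap.sum_apply, Finset.sum_apply, Matrix.mul_apply]
    exact Finset.sum_congr rfl fun l _ => mul_comm _ _
  -- The answers are linear in the content, so it suffices to treat the difference of the messages,
  -- whose answers are all zero.
  have key := eq_zero_of_share_answers hI σ Ψ y fun j i x => by
    have h0 : respond ι j (shareMap σ η j ∘ₗ Ψ.toLinearMap) (stored G (w - w') j) i x = 0 := by
      rw [stored_sub, respond_sub, h j, sub_self]
      rfl
    have h1 := congrArg (compLinearMapLM η.toLinearMap (i + 1)) h0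
    rw [map_zero] at h1
    have h2 := (alternatizeUncurryFin_compLinearMap _ η.toLinearMap).symm.trans h1
    rw [← h2, hy]
    congr 1
    refine LinearMap.ext fun e => ?_
    exact (compLinearMapLM_symm η i _).symm
  have hsub : Fintype.linearCombination F (w - w') (ι (η (1, 0))) = 0 := by
    ext t l
    exact congrFun (key l) t
  rw [linearCombination_sub, LinearMap.sub_apply, sub_eq_zero] at hsub
  exact hsub

/-- The encoding of a finite-dimensional space by coordinate vectors. -/
noncomputable def encode (F Q : Type*) [Field F] [AddCommGroup Q] [Module F Q]
    [Module.Finite F Q] : Q ≃ₗ[F] (Fin (Module.finrank F Q) → F) :=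
  (Module.finBasis F Q).equivFun

variable [Module.Finite F E]

/-- The scheme in which the blocks are the images of the coordinates under a random isomorphism,
and the databases answer with alternations of their shares. -/
noncomputable def alternatingScheme (σ : Pairings d I c) (ι : E →ₗ[F] Fin f → F)
    (η : Fin μ → ((F × B) ≃ₗ[F] E)) [Fintype ((Fin β → F) ≃ₗ[F] Blocks F B d ν c)]
    [Nonempty ((Fin β → F) ≃ₗ[F] Blocks F B d ν c)] : Scheme F n f β μ where
  querySize j := Module.finrank F ((Fin β → F) →ₗ[F] Shares F E d I c j)
  answerSize j := Module.finrank F (Responses F E d I c j)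
  queryLaw v := (PMF.uniformOfFintype ((Fin β → F) ≃ₗ[F] Blocks F B d ν c)).map fun Ψ j =>
    encode F _ (shareMap σ (η v) j ∘ₗ Ψ.toLinearMap)
  answer j q y := encode F _ (respond ι j ((encode F _).symm q) y)

theorem exists_linearEquiv_apply_eq [Module.Finite F B]
    (hd : Module.finrank F E = Module.finrank F B + 1) {a : E}
    (ha : a ≠ 0) : ∃ η : (F × B) ≃ₗ[F] E, η (1, 0) = a := by
  obtain ⟨C, hC⟩ := Submodule.exists_isCompl (F ∙ a)
  have h1 := Submodule.finrank_add_eq_of_isCompl hC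
  rw [finrank_span_singleton ha] at h1
  refine ⟨((LinearEquiv.toSpanNonzeroSingleton F E a ha).prodCongr
    (LinearEquiv.ofFinrankEq B C (by omega))) ≪≫ₗ Submodule.prodEquivOfIsCompl _ _ hC, ?_⟩
  simp

variable [Fintype F]

theorem alternatingScheme_isPrivate [Module.Finite F B] (σ : Pairings d I c) (ι : E →ₗ[F] Fin f → F)
    (η : Fin μ → ((F × B) ≃ₗ[F] E)) [Fintype ((Fin β → F) ≃ₗ[F] Blocks F B d ν c)]
    [Nonempty ((Fin β → F) ≃ₗ[F] Blocks F B d ν c)] (G : Matrix (Fin k) (Fin n) F)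
    (V : Matrix (Fin μ) (Fin f) F) :
    (alternatingScheme (β := β) σ ι η).IsPrivate G V := by
  refine Scheme.isPrivate_of_map_queryLaw_eq G V fun j v v' => ?_
  obtain ⟨h, hh⟩ := exists_linearEquiv_comp_eq (shareMap_surjective σ (η v') j)
    (shareMap_surjective σ (η v) j)
  -- The automorphism relating the share maps of the two requests acts by composition on the random
  -- isomorphisms and preserves their uniform law.
  let e : ((Fin β → F) ≃ₗ[F] Blocks F B d ν c) ≃ ((Fin β → F) ≃ₗ[F] Blocks F B d ν c) :=
    { toFun := fun Ψ => Ψ ≪≫ₗ h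
      invFun := fun Ψ => Ψ ≪≫ₗ h.symm
      left_inv := fun Ψ => by ext : 1; simp
      right_inv := fun Ψ => by ext : 1; simp }
  simp only [alternatingScheme]
  rw [PMF.map_comp, PMF.map_comp]
  conv_rhs => rw [← map_uniformOfFintype_equiv e, PMF.map_comp]
  congr 1
  funext Ψ
  change encode F _ _ = encode F _ _
  congr 1
  exact LinearMap.ext fun x => hh _

theorem alternatingScheme_isRecoverable {G : Matrix (Fin k) (Fin n) F}
    (hI : ∀ u, IsInformationSet G (I u)) (σ : Pairings d I c) (ι : E →ₗ[F] Fin f → F)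
    (η : Fin μ → ((F × B) ≃ₗ[F] E)) [Fintype ((Fin β → F) ≃ₗ[F] Blocks F B d ν c)]
    [Nonempty ((Fin β → F) ≃ₗ[F] Blocks F B d ν c)] {V : Matrix (Fin μ) (Fin f) F}
    (hη : ∀ v, V v ≠ 0 → ι (η v (1, 0)) = V v) :
    (alternatingScheme (β := β) σ ι η).IsRecoverable G V := by
  refine Scheme.isRecoverable_of_forall fun v q hq w w' hw => ?_
  rw [linFun_eq_linearCombination, linFun_eq_linearCombination]
  by_cases h0 : V v = 0
  · rw [h0, map_zero, map_zero]
  obtain ⟨Ψ, -, rfl⟩ := (PMF.mem_support_map_iff _ _ _).1 hq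
  rw [← hη v h0]
  refine linearCombination_eq_of_respond_eq hI σ ι (η v) Ψ fun j => ?_
  have h1 := (encode F (Responses F E d I c j)).injective (congrFun hw j)
  simpa using h1

end Construction

/-! ### Dimensions of blocks and responses -/

section Counting

variable {F : Type*} [Field F] {n d ν κ : ℕ} {I : Fin ν → Finset (Fin n)}

/-- The number of forms of degree `i` for every information set. -/
def blockCount (d κ δ i : ℕ) : ℕ := κ ^ (d - i) * δ ^ i

theorem card_mem_eq (hcol : ∀ j, (Finset.univ.filter fun u => j ∈ I u).card = κ) (j : Fin n) :
    Fintype.card {u // j ∈ I u} = κ := by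
  rw [Fintype.card_subtype, hcol]

/-- The block counts are chosen for this balance: κ c(i+1) = (ν - κ) c(i). -/
theorem nonempty_pairings (hcol : ∀ j, (Finset.univ.filter fun u => j ∈ I u).card = κ) :
    Nonempty (Pairings d I (blockCount d κ (ν - κ))) := by
  refine ⟨fun j i hi => Fintype.equivOfCardEq ?_⟩
  rw [Fintype.card_prod, Fintype.card_prod, Fintype.card_subtype_compl, card_mem_eq hcol,
    Fintype.card_fin, Fintype.card_fin, Fintype.card_fin]
  unfold blockCount
  obtain ⟨e, rfl⟩ := Nat.exists_eq_add_of_lt hi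
  rw [show i + e + 1 - (i + 1) = e by omega, show i + e + 1 - i = e + 1 by omega]
  ring

theorem finrank_blocks (hκ : κ ≤ ν) :
    Module.finrank F (Blocks F (Fin d → F) d ν (blockCount d κ (ν - κ))) = ν ^ (d + 1) := by
  rw [Module.finrank_pi_fintype]
  simp_rw [Module.finrank_pi_fintype, finrank_alternatingForms, Module.finrank_fin_fun,
    Finset.sum_const, Finset.card_univ, Fintype.card_prod, Fintype.card_fin, smul_eq_mul]
  rw [Fin.sum_univ_eq_sum_range (fun i => ν * blockCount d κ (ν - κ) i * d.choose i) (d + 1)]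
  have h := add_pow (ν - κ) κ d
  rw [Nat.sub_add_cancel hκ] at h
  rw [pow_succ', h, Finset.mul_sum]
  refine Finset.sum_congr rfl fun i _ => ?_
  unfold blockCount
  push_cast
  ring

theorem finrank_responses (hκ : κ ≤ ν)
    (hcol : ∀ j, (Finset.univ.filter fun u => j ∈ I u).card = κ) {E : Type*} [AddCommGroup E]
    [Module F E] [Module.Finite F E] (hE : Module.finrank F E = d + 1) (j : Fin n) :
    (ν - κ) * Module.finrank F (Responses F E d I (blockCount d κ (ν - κ)) j) +
      κ * κ ^ (d + 1) = κ * ν ^ (d + 1) := by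
  rw [Module.finrank_pi_fintype]
  simp_rw [Module.finrank_pi_fintype, finrank_alternatingForms, hE,
    Finset.sum_const, Finset.card_univ, Fintype.card_prod, card_mem_eq hcol, Fintype.card_fin,
    smul_eq_mul]
  rw [Fin.sum_univ_eq_sum_range
    (fun i => κ * blockCount d κ (ν - κ) i * (d + 1).choose (i + 1)) (d + 1)]
  have h := add_pow (ν - κ) κ (d + 1)
  -- Responses start in degree 1, so the degree 0 term of the binomial expansion is missing; it is
  -- the summand κ · κ^(d+1) in the statement.
  rw [Nat.sub_add_cancel hκ, Finset.sum_range_succ'] at h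
  rw [h, mul_add, Finset.mul_sum, Finset.mul_sum]
  congr 1
  · refine Finset.sum_congr rfl fun i _ => ?_
    unfold blockCount
    rw [Nat.add_sub_add_right]
    push_cast
    ring
  · simp

end Counting

/-! ### Assembly of the protocol and the capacity -/

/-- A protocol whose rate is the capacity. -/
theorem exists_protocol_rate_eq {F : Type*} [Field F] [Fintype F] {n k f μ d κ ν : ℕ}
    (hn : 0 < n) {G : Matrix (Fin k) (Fin n) F} {V : Matrix (Fin μ) (Fin f) F}
    (hV : V.rank = d + 1) {I : Fin ν → Finset (Fin n)} (hκ : 0 < κ) (hκν : κ < ν)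
    (hrat : κ * n = k * ν) (hI : ∀ u, IsInformationSet G (I u))
    (hcol : ∀ j, (Finset.univ.filter fun u => j ∈ I u).card = κ) :
    ∃ β, 0 < β ∧ ∃ P : Protocol G V β,
      P.rate = (1 - (k : ℝ) / n) * (1 - ((k : ℝ) / n) ^ (d + 1))⁻¹ := by
  let E := Submodule.span F (Set.range V.row)
  have hE : Module.finrank F E = d + 1 := by
    rw [← hV, Matrix.rank_eq_finrank_span_row]
  have hEB : Module.finrank F E = Module.finrank F (Fin d → F) + 1 := by
    rw [hE, Module.finrank_fin_fun]
  have hη : ∀ v, ∃ η : (F × (Fin d → F)) ≃ₗ[F] E, V v ≠ 0 → (η (1, 0) : Fin f → F) = V v := by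
    intro v
    -- A zero row has nothing to decode, but privacy still demands a query of the same law, so any
    -- isomorphism is used.
    by_cases h0 : V v = 0
    · refine ⟨LinearEquiv.ofFinrankEq _ _ ?_, fun h => absurd h0 h⟩
      rw [hEB, Module.finrank_prod, Module.finrank_self, add_comm]
    · have hmem : V v ∈ E := Submodule.subset_span ⟨v, rfl⟩
      obtain ⟨η, h⟩ := exists_linearEquiv_apply_eq hEB (a := ⟨V v, hmem⟩)
        fun h => h0 (congrArg Subtype.val h)
      exact ⟨η, fun _ => congrArg Subtype.val h⟩
  choose η hη using hη
  obtain ⟨σ⟩ := nonempty_pairings (d := d) hcol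
  let β := ν ^ (d + 1)
  have hβ : 0 < β := pow_pos (hκ.trans hκν) _
  let S := Blocks F (Fin d → F) d ν (blockCount d κ (ν - κ))
  have hne : Nonempty ((Fin β → F) ≃ₗ[F] S) :=
    ⟨LinearEquiv.ofFinrankEq _ _ (by rw [Module.finrank_fin_fun, finrank_blocks hκν.le])⟩
  have hfS : Finite S := Module.finite_of_finite F
  have hfin : Finite ((Fin β → F) ≃ₗ[F] S) := DFunLike.finite _
  have := Fintype.ofFinite ((Fin β → F) ≃ₗ[F] S)
  let P : Protocol G V β :=
    { toScheme := alternatingScheme σ E.subtype η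
      isPrivate := alternatingScheme_isPrivate σ E.subtype η G V
      isRecoverable := alternatingScheme_isRecoverable hI σ E.subtype η hη }
  refine ⟨β, hβ, P, ?_⟩
  have hA := finrank_responses (F := F) hκν.le hcol hE
  have hans : ∀ j, (P.answerSize j : ℝ) =
      κ * (ν ^ (d + 1) - κ ^ (d + 1)) / (ν - κ) := by
    intro j
    have h1 := congrArg (Nat.cast (R := ℝ)) (hA j)
    push_cast [hκν.le] at h1
    have h2 : (ν : ℝ) - κ ≠ 0 := sub_ne_zero.2 (by exact_mod_cast hκν.ne')
    rw [eq_div_iff h2]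
    change (Module.finrank F (Responses F E d I (blockCount d κ (ν - κ)) j) : ℝ) * _ = _
    linarith
  unfold Protocol.rate
  simp_rw [hans]
  rw [Finset.sum_const, Finset.card_univ, Fintype.card_fin, nsmul_eq_mul]
  have hx : (k : ℝ) / n = κ / ν := by
    have : 0 < ν := hκ.trans hκν
    rw [div_eq_div_iff (by positivity) (by positivity)]
    exact_mod_cast hrat.symm
  have hν0 : (0 : ℝ) < ν := by exact_mod_cast hκ.trans hκν
  have hκ0 : (0 : ℝ) < κ := by exact_mod_cast hκ
  have hn0 : (0 : ℝ) < n := by exact_mod_cast hn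
  have hlt : (κ : ℝ) < ν := by exact_mod_cast hκν
  have hpow : (κ : ℝ) ^ (d + 1) < ν ^ (d + 1) := pow_lt_pow_left₀ hlt hκ0.le (Nat.succ_ne_zero d)
  have hk' : (k : ℝ) = κ / ν * n := by rw [← hx, div_mul_cancel₀ _ hn0.ne']
  rw [hx]
  push_cast
  rw [hk', div_pow]
  have h1 : (ν : ℝ) ^ (d + 1) - κ ^ (d + 1) ≠ 0 := (sub_pos.2 hpow).ne'
  have h2 : (ν : ℝ) - κ ≠ 0 := (sub_pos.2 hlt).ne'
  have h3 : 1 - (κ : ℝ) ^ (d + 1) / ν ^ (d + 1) =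
      (ν ^ (d + 1) - κ ^ (d + 1)) / ν ^ (d + 1) := by
    field_simp
  rw [h3, inv_div]
  simp only [β]
  push_cast
  field_simp

end PLC

theorem theorem2 {F : Type*} [Field F] [Fintype F] {n k f μ r : ℕ} (hk : 0 < k) (hkn : k < n)
    (G : Matrix (Fin k) (Fin n) F) (hG : PLC.IsGeneratorMatrix G)
    (hC : PLC.IsMDSPIRCapacityAchieving G)
    (V : Matrix (Fin μ) (Fin f) F) (hV : V.rank = r) (hr : 0 < r) :
    PLC.IsCapacity G V ((1 - (k : ℝ) / n) * (1 - ((k : ℝ) / n) ^ r)⁻¹) := by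
  obtain ⟨κ, ν, I, hκ, hκν, hrat, hI, hcol⟩ := hC.exists_informationSets hk hkn
  have hν : 0 < ν := hκ.trans hκν
  have hn : 0 < n := hk.trans hkn
  have hx : (κ : ℝ) / ν = k / n := by
    rw [div_eq_div_iff (by positivity) (by positivity)]
    exact_mod_cast hrat
  have hx1 : (k : ℝ) / n < 1 := (div_lt_one (by positivity)).2 (by exact_mod_cast hkn)
  have hx0 : (0 : ℝ) < (k : ℝ) / n := by positivity
  set x : ℝ := (k : ℝ) / n with hxdef
  have hgeom : ∑ i ∈ Finset.range r, x ^ i = (1 - x ^ r) / (1 - x) := by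
    rw [geom_sum_eq hx1.ne, ← neg_div_neg_eq, neg_sub, neg_sub]
  have hxr : x ^ r < 1 := pow_lt_one₀ hx0.le hx1 hr.ne'
  have hC0 : 0 < (1 - x) * (1 - x ^ r)⁻¹ :=
    mul_pos (sub_pos.2 hx1) (inv_pos.2 (sub_pos.2 hxr))
  have hdiv : ∀ L D : ℝ, 0 ≤ D → L * ∑ i ∈ Finset.range r, x ^ i ≤ D →
      L / D ≤ (1 - x) * (1 - x ^ r)⁻¹ := by
    intro L D hD h
    -- A zero download gives the quotient 0 by convention, which is below the bound.
    rcases hD.eq_or_lt with h0 | h0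
    · rw [← h0, div_zero]
      exact hC0.le
    · rw [div_le_iff₀ h0]
      rw [hgeom] at h
      have h1 : 0 < 1 - x := sub_pos.2 hx1
      have h2 : 0 < 1 - x ^ r := sub_pos.2 hxr
      calc L = (1 - x) * (1 - x ^ r)⁻¹ * (L * ((1 - x ^ r) / (1 - x))) := by
            field_simp
        _ ≤ _ := mul_le_mul_of_nonneg_left h hC0.le
  have hlog : 0 < Real.log (Fintype.card F) :=
    Real.log_pos (by exact_mod_cast Fintype.one_lt_card)
  have hnn : ∀ {β : ℕ} (P : PLC.Protocol G V β) v j, 0 ≤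
      PLC.entropy (Fintype.card F) (P.law k v) fun y => P.reply G y j := fun P v j => by
    rw [PLC.entropy_eq_ent]
    exact div_nonneg (PLC.ent_nonneg _ _) hlog.le
  have hle : ∀ {β : ℕ} (P : PLC.Protocol G V β) v j,
      PLC.entropy (Fintype.card F) (P.law k v) (fun y => P.reply G y j) ≤ P.answerSize j :=
    fun P v j => by
      rw [PLC.entropy_eq_ent, div_le_iff₀ hlog]
      refine (PLC.ent_le_log_card _ _).trans (le_of_eq ?_)
      simp
  have hconv : ∀ {β : ℕ} (P : PLC.Protocol G V β) v, (β * k : ℕ) * ∑ i ∈ Finset.range r, x ^ i ≤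
      ∑ j, PLC.entropy (Fintype.card F) (P.law k v) (fun y => P.reply G y j) := by
    intro β P v
    rw [← hx]
    exact P.mul_sum_pow_le hV hν hI hcol v
  obtain ⟨τ, -⟩ := PLC.exists_linearIndependent_rows hV
  let v₀ : Fin μ := τ ⟨0, hr⟩
  obtain ⟨d, rfl⟩ : ∃ d, r = d + 1 := ⟨r - 1, by omega⟩
  obtain ⟨β, hβ, P, hP⟩ := PLC.exists_protocol_rate_eq hn hV hκ hκν hrat hI hcol
  have hupper : ∀ {β : ℕ} (P : PLC.Protocol G V β) v,
      P.entropyRate v ≤ (1 - x) * (1 - x ^ (d + 1))⁻¹ := fun P v =>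
    hdiv _ _ (Finset.sum_nonneg fun j _ => hnn P v j) (hconv P v)
  -- One protocol attains both maxima: answer entropies are at most answer lengths, so its entropy
  -- rate lies between its symbol rate and the converse bound, which coincide.
  refine ⟨⟨⟨β, hβ, P, hP.symm⟩, ?_⟩, ⟨⟨β, hβ, P, v₀, le_antisymm ?_ (hupper P v₀)⟩, ?_⟩⟩
  · rintro _ ⟨β, -, P, rfl⟩
    exact hdiv _ _ (by positivity)
      ((hconv P v₀).trans (Finset.sum_le_sum fun j _ => hle P v₀ j))
  · rw [← hP]
    have hL : (0 : ℝ) < (β * k : ℕ) := by exact_mod_cast Nat.mul_pos hβ hk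
    refine div_le_div_of_nonneg_left hL.le ?_ (Finset.sum_le_sum fun j _ => hle P v₀ j)
    refine lt_of_lt_of_le (mul_pos hL ?_) (hconv P v₀)
    rw [hgeom]
    exact div_pos (sub_pos.2 hxr) (sub_pos.2 hx1)
  · rintro _ ⟨β, -, P, v, rfl⟩
    exact hupper P v
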